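/- \textbf{Annotated Weighted Vertex Integrity with Vertex Cover.} The input consists of a finite simple graph $G=(V,E)$ with $n$ vertices and positive integer vertex weights $w:V\to\mathbb{Z}^+$, a vertex cover $C\subseteq V$ of $G$, and an integer $w_{\max}$. For $S\subseteq V$, let $\mathrm{cc}(G-S)$ be the set of (vertex sets of) connected components of $G-S$, and write $w(X)=\sum_{v\in X}w(v)$. A vertex $v\in S$ is redundant if at most one component in $\mathrm{cc}(G-S)$ contains neighbours of $v$; the set $S$ is irredundant if it contains no redundant vertex. Call $S$ feasible if $S\subseteq V\setminus C$, $S$ is irredundant, and $w(D)\le w_{\max}$ for all $D\in\mathrm{cc}(G-S)$. The task is to output a feasible set $S$ of minimum weight $w(S)$, or to report NO if no feasible set exists. \textbf{Theorem.} Annotated Weighted Vertex Integrity with Vertex Cover can be solved in time $2^{O(|C|)}\,n^{O(1)}$. That is, there is a single program for the unit-cost random access machine (integer registers and memory cells; additions, subtractions, indirect loads and stores, and sign tests cost one step each; no multiplication), and there are constants $A,a,b$, such that on every input, given by the weights, the indicator of $C$, the adjacency matrix, $n$ and $w_{\max}$, the program halts with a correct output after at most $A\cdot 2^{a|C|}\cdot(n+1)^{b}$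 steps. -/

import Mathlib

namespace WVI

/-! ### Components, separators and irredundancy -/

section Graph

variable {V : Type*}

/-- The vertex sets of the connected components of `G - S`. -/
def cc (G : SimpleGraph V) (S : Set V) : Set (Set V) :=
  {D | ∃ K : (G.induce Sᶜ).ConnectedComponent, D = Subtype.val '' K.supp}

/-- `v` is redundant for `S`: it lies in `S`, and at most one connected component of `G - S`
contains neighbours of `v`. -/
def Redundant (G : SimpleGraph V) (S : Set V) (v : V) : Prop :=
  v ∈ S ∧ {D ∈ cc G S | ∃ u ∈ D, G.Adj v u}.Subsingleton

/-- `S` contains no redundant vertex. -/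
def Irredundant (G : SimpleGraph V) (S : Set V) : Prop :=
  ∀ v, ¬ Redundant G S v

/-- The total weight of a set of vertices. -/
noncomputable def weight [Fintype V] (w : V → ℤ) (D : Set V) : ℤ :=
  ∑ v, D.indicator w v

end Graph

/-! ### The problem -/

/-- An input of Annotated Weighted Vertex Integrity with Vertex Cover: a graph on the vertex set
`{0, …, n - 1}` with positive integer vertex weights, a vertex cover `C` of it, and an integer
`wmax`. -/
structure Input where
  n : ℕ
  G : SimpleGraph (Fin n)
  w : Fin n → ℤ
  w_pos : ∀ v, 0 < w v
  C : Finset (Fin n)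
  cover : G.IsVertexCover (C : Set (Fin n))
  wmax : ℤ

/-- `S` is an irredundant set of vertices outside the cover, and every connected component of
`G - S` has weight at most `wmax`. -/
def Input.Feasible (I : Input) (S : Set (Fin I.n)) : Prop :=
  S ⊆ (I.C : Set (Fin I.n))ᶜ ∧ Irredundant I.G S ∧ ∀ D ∈ cc I.G S, weight I.w D ≤ I.wmax

/-- `S` is a feasible set of minimum weight. -/
def Input.Optimal (I : Input) (S : Set (Fin I.n)) : Prop :=
  I.Feasible S ∧ ∀ T, I.Feasible T → weight I.w S ≤ weight I.w T

/-! ### The machine model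

A random access machine with integer registers and an integer memory addressed by natural
numbers. Addition, subtraction, indirect loads and stores, and sign tests take one step each. There
is no multiplication, division or shift: a value can grow by at most one bit per step, so that unit
cost and logarithmic cost are polynomially related. -/

/-- A state of the machine. A program mentions only finitely many registers. -/
structure State where
  reg : ℕ → ℤ
  mem : ℕ → ℤ

/-- The state `s` after register `r` has received the value `z`. -/
def State.setReg (s : State) (r : ℕ) (z : ℤ) : State :=
  { s with reg := Function.update s.reg r z }

/-- The state `s` after memory cell `i` has received the value `z`. -/
def State.setMem (s : State) (i : ℕ) (z : ℤ) : State :=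
  { s with mem := Function.update s.mem i z }

/-- Programs of the machine; the arguments `r`, `a`, `b` are numbers of registers. -/
inductive Program : Type
  | skip : Program
  | const (r : ℕ) (z : ℤ) : Program
  | move (r a : ℕ) : Program
  | add (r a b : ℕ) : Program
  | sub (r a b : ℕ) : Program
  | load (r a : ℕ) : Program
  | store (a r : ℕ) : Program
  | seq (p q : Program) : Program
  | ifPos (r : ℕ) (p q : Program) : Program
  | whilePos (r : ℕ) (p : Program) : Program

/-- `Exec p s t s'`: the program `p`, started in state `s`, halts in state `s'` after exactly `t`
steps. Every elementary instruction and every evaluation of a test is one step. A load or store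
with a negative address has no halting run. -/
inductive Exec : Program → State → ℕ → State → Prop
  | skip (s : State) : Exec .skip s 1 s
  | const (s : State) (r : ℕ) (z : ℤ) : Exec (.const r z) s 1 (s.setReg r z)
  | move (s : State) (r a : ℕ) : Exec (.move r a) s 1 (s.setReg r (s.reg a))
  | add (s : State) (r a b : ℕ) : Exec (.add r a b) s 1 (s.setReg r (s.reg a + s.reg b))
  | sub (s : State) (r a b : ℕ) : Exec (.sub r a b) s 1 (s.setReg r (s.reg a - s.reg b))
  | load (s : State) (r a i : ℕ) (h : s.reg a = (i : ℤ)) :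
      Exec (.load r a) s 1 (s.setReg r (s.mem i))
  | store (s : State) (a r i : ℕ) (h : s.reg a = (i : ℤ)) :
      Exec (.store a r) s 1 (s.setMem i (s.reg r))
  | seq (p q : Program) (s s' s'' : State) (t t' : ℕ) (hp : Exec p s t s')
      (hq : Exec q s' t' s'') : Exec (.seq p q) s (t + t') s''
  | ifTrue (r : ℕ) (p q : Program) (s s' : State) (t : ℕ) (h : 0 < s.reg r)
      (hp : Exec p s t s') : Exec (.ifPos r p q) s (t + 1) s'
  | ifFalse (r : ℕ) (p q : Program) (s s' : State) (t : ℕ) (h : ¬ 0 < s.reg r)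
      (hq : Exec q s t s') : Exec (.ifPos r p q) s (t + 1) s'
  | whileStep (r : ℕ) (p : Program) (s s' s'' : State) (t t' : ℕ) (h : 0 < s.reg r)
      (hp : Exec p s t s') (hw : Exec (.whilePos r p) s' t' s'') :
      Exec (.whilePos r p) s (t + t' + 1) s''
  | whileDone (r : ℕ) (p : Program) (s : State) (h : ¬ 0 < s.reg r) :
      Exec (.whilePos r p) s 1 s

/-- The machine is deterministic: the halting run is unique, if there is one. -/
theorem Exec.unique {p : Program} {s s₁ s₂ : State} {t₁ t₂ : ℕ}
    (h₁ : Exec p s t₁ s₁) (h₂ : Exec p s t₂ s₂) : t₁ = t₂ ∧ s₁ = s₂ := by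
  induction h₁ generalizing t₂ s₂ with
  | skip | const | move | add | sub => cases h₂; exact ⟨rfl, rfl⟩
  | load s r a i h =>
    cases h₂ with
    | load _ _ _ j h' =>
      obtain rfl : i = j := by exact_mod_cast h.symm.trans h'
      exact ⟨rfl, rfl⟩
  | store s a r i h =>
    cases h₂ with
    | store _ _ _ j h' =>
      obtain rfl : i = j := by exact_mod_cast h.symm.trans h'
      exact ⟨rfl, rfl⟩
  | seq p q s s' s'' t t' _ _ ihp ihq =>
    cases h₂ with
    | seq _ _ _ _ _ _ _ hp hq =>
      obtain ⟨rfl, rfl⟩ := ihp hp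
      obtain ⟨rfl, rfl⟩ := ihq hq
      exact ⟨rfl, rfl⟩
  | ifTrue r p q s s' t h _ ih =>
    cases h₂ with
    | ifTrue _ _ _ _ _ _ _ hp => obtain ⟨rfl, rfl⟩ := ih hp; exact ⟨rfl, rfl⟩
    | ifFalse _ _ _ _ _ _ h' => exact absurd h h'
  | ifFalse r p q s s' t h _ ih =>
    cases h₂ with
    | ifTrue _ _ _ _ _ _ h' => exact absurd h' h
    | ifFalse _ _ _ _ _ _ _ hp => obtain ⟨rfl, rfl⟩ := ih hp; exact ⟨rfl, rfl⟩
  | whileStep r p s s' s'' t t' h _ _ ihp ihw =>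
    cases h₂ with
    | whileStep _ _ _ _ _ _ _ _ hp hw =>
      obtain ⟨rfl, rfl⟩ := ihp hp
      obtain ⟨rfl, rfl⟩ := ihw hw
      exact ⟨rfl, rfl⟩
    | whileDone _ _ _ h' => exact absurd h h'
  | whileDone r p s h =>
    cases h₂ with
    | whileStep _ _ _ _ _ _ _ h' => exact absurd h' h
    | whileDone => exact ⟨rfl, rfl⟩

/-! ### Input and output conventions -/

open Classical in
/-- The initial contents of the memory: the `n` weights, then the `n` indicators of membership in
`C`, then the `n * n` entries of the adjacency matrix, row by row. -/
noncomputable def Input.cells (I : Input) : List ℤ :=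
  List.ofFn I.w ++ List.ofFn (fun v : Fin I.n => if v ∈ I.C then (1 : ℤ) else 0) ++
    List.ofFn (fun k : Fin (I.n * I.n) => if I.G.Adj k.divNat k.modNat then (1 : ℤ) else 0)

/-- The initial state on input `I`: register `0` holds `n`, register `1` holds `wmax`, the memory
starts with `I.cells`, and everything else is `0`. -/
noncomputable def Input.init (I : Input) : State where
  reg r := if r = 0 then (I.n : ℤ) else if r = 1 then I.wmax else 0
  mem i := I.cells.getD i 0

open Classical in
/-- The final state `s` is a correct answer to `I`. Either register `0` holds `1` and the first `n`
memory cells hold the indicator of a minimum weight feasible set, or register `0` holds `0`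
(the answer NO) and there is no feasible set. -/
def Input.CorrectAnswer (I : Input) (s : State) : Prop :=
  (s.reg 0 = 1 ∧ ∃ S : Set (Fin I.n), I.Optimal S ∧
      ∀ v : Fin I.n, s.mem v = if v ∈ S then 1 else 0) ∨
    (s.reg 0 = 0 ∧ ¬ ∃ S : Set (Fin I.n), I.Feasible S)

end WVI

/-!
# Weighted vertex integrity parameterized by a vertex cover

Outside the cover `C` the graph has no edges, so a feasible set `S` is determined by the partition
of `C` into its traces on the components of `G - S`: a vertex `v` outside `C` whose neighbourhood
meets two parts must be deleted, and a vertex whose neighbourhood lies in one part would be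
redundant. The kept weight is the sum of a *gain* `gain Y` over the parts `Y`, up to the isolated
vertices outside `C`, and the gain depends on `Y` alone. The components are connected, but this need
not be demanded of the parts: if no edge of `G[C]` leaves a part and its gain is at most `wmax`,
then every component of `G - S` that meets the part has weight at most the gain, and the vertices of
`S` still see two components. Hence feasible sets of minimum weight correspond to partitions of `C`
into *good* parts of maximum total gain (`feasible_separator`, `weight_separator`,
`exists_partition_of_feasible`). A feasible set exists if and only if there is such a partition and
no isolated vertex outside `C` is heavier than `wmax`.

The best partition is found by dynamic programming over the subsets of `C`: the value of `X` is the
maximum of `gain Y` plus the value of `X \ Y`, over the nonempty good `Y ⊆ X`. Trying all pairs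
costs `4 ^ |C|` rounds, each of quadratic cost.

The machine has no bit operations. A subset of `C` is coded by the sum of the place values of its
elements, where the place values are consecutive powers of two, and the digits of a code are read
off greedily from the largest place value downwards (`codeBelow_lt`). Codes turn the difference of
a set and a subset into the difference of numbers (`code_sdiff_add`). Loop-free pieces of the
program are verified through their weakest preconditions (`Runs.of_wp`), loops through invariants
(`Runs.whilePos`); both count steps.
-/

namespace WVI

/-! ### Components and traces on the cover -/

section Component

variable {V : Type*}

/-- A property that is passed on along the edges of `G - S` holds on a whole component once it holds
at one of its vertices. -/
theorem mem_of_mem_cc {G : SimpleGraph V} {S D : Set V} (hD : D ∈ cc G S) {P : V → Prop}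
    (hP : ∀ x y, x ∉ S → y ∉ S → G.Adj x y → P x → P y) {x y : V} (hx : x ∈ D) (hy : y ∈ D)
    (h : P x) : P y := by
  obtain ⟨K, rfl⟩ := hD
  obtain ⟨x, hx, rfl⟩ := hx
  obtain ⟨y, hy, rfl⟩ := hy
  have hr : (G.induce Sᶜ).Reachable x y :=
    SimpleGraph.ConnectedComponent.exact (hx.trans hy.symm)
  obtain ⟨p⟩ := hr
  clear hx hy
  induction p with
  | nil => exact h
  | @cons a b _ hadj _ ih => exact ih (hP a b a.2 b.2 hadj h)

theorem not_mem_of_mem_cc {G : SimpleGraph V} {S D : Set V} (hD : D ∈ cc G S) {x : V}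
    (hx : x ∈ D) : x ∉ S := by
  obtain ⟨K, rfl⟩ := hD
  obtain ⟨x, hx, rfl⟩ := hx
  exact x.2

theorem exists_mem_cc {G : SimpleGraph V} {S : Set V} {x : V} (hx : x ∉ S) :
    ∃ D ∈ cc G S, x ∈ D :=
  ⟨_, ⟨(G.induce Sᶜ).connectedComponentMk ⟨x, hx⟩, rfl⟩, ⟨x, hx⟩, rfl, rfl⟩

theorem mem_cc_of_adj {G : SimpleGraph V} {S D : Set V} (hD : D ∈ cc G S) {x y : V}
    (hx : x ∈ D) (hy : y ∉ S) (h : G.Adj x y) : y ∈ D := by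
  obtain ⟨K, rfl⟩ := hD
  obtain ⟨x, hx, rfl⟩ := hx
  refine ⟨⟨y, hy⟩, ?_, rfl⟩
  have : (G.induce Sᶜ).Adj x ⟨y, hy⟩ := h
  exact (SimpleGraph.ConnectedComponent.sound this.reachable.symm).trans hx

theorem cc_eq_of_mem {G : SimpleGraph V} {S D D' : Set V} (hD : D ∈ cc G S) (hD' : D' ∈ cc G S)
    {x : V} (hx : x ∈ D) (hx' : x ∈ D') : D = D' := by
  ext y
  constructor
  · intro hy
    exact mem_of_mem_cc hD (P := fun z => z ∈ D')
      (fun a b _ hb hab ha => mem_cc_of_adj hD' ha hb hab) hx hy hx'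
  · intro hy
    exact mem_of_mem_cc hD' (P := fun z => z ∈ D)
      (fun a b _ hb hab ha => mem_cc_of_adj hD ha hb hab) hx' hy hx

theorem weight_mono [Fintype V] {w : V → ℤ} (hw : ∀ v, 0 < w v) {A B : Set V} (h : A ⊆ B) :
    weight w A ≤ weight w B :=
  Finset.sum_le_sum fun v _ => Set.indicator_le_indicator_of_subset h (fun v => (hw v).le) v

theorem weight_singleton [Fintype V] {w : V → ℤ} {v : V} : weight w {v} = w v := by
  classical
  simp [weight, Set.indicator_apply]

end Component

section Trace

variable {V : Type*} [DecidableEq V]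

open Classical in
/-- The trace on the cover `C` of the closed neighbourhood of `v`. -/
noncomputable def trace (G : SimpleGraph V) (C : Finset V) (v : V) : Finset V :=
  {u ∈ C | u = v ∨ G.Adj v u}

theorem mem_trace {G : SimpleGraph V} {C : Finset V} {u v : V} :
    u ∈ trace G C v ↔ u ∈ C ∧ (u = v ∨ G.Adj v u) := by
  simp [trace]

theorem self_mem_trace {G : SimpleGraph V} {C : Finset V} {v : V} (h : v ∈ C) :
    v ∈ trace G C v := by
  simp [mem_trace, h]

theorem trace_subset {G : SimpleGraph V} {C : Finset V} {v : V} : trace G C v ⊆ C :=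
  fun _ h => (mem_trace.1 h).1

theorem trace_eq_empty_iff {G : SimpleGraph V} {C : Finset V}
    (hC : G.IsVertexCover (C : Set V)) {v : V} :
    trace G C v = ∅ ↔ v ∉ C ∧ ∀ u, ¬ G.Adj v u := by
  constructor
  · intro h
    have hv : v ∉ C := fun hv => by simpa [h] using self_mem_trace (G := G) hv
    refine ⟨hv, fun u hu => ?_⟩
    rcases hC hu with h' | h'
    · exact hv h'
    · have : u ∈ trace G C v := mem_trace.2 ⟨h', Or.inr hu⟩
      simp [h] at this
  · rintro ⟨h1, h2⟩
    ext u
    simp only [mem_trace, Finset.notMem_empty, iff_false, not_and, not_or]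
    exact fun hu => ⟨fun e => h1 (e ▸ hu), h2 u⟩

end Trace

/-! ### Partitions of the cover -/

section Partition

variable {V : Type*} [Fintype V] [DecidableEq V]

/-- The total weight of the vertices whose trace on the cover is a nonempty subset of `Y`. If `Y`
is a part of the cover, this is the weight that the part keeps in `G - S`. -/
def gain (L : V → Finset V) (w : V → ℤ) (Y : Finset V) : ℤ :=
  ∑ v, if (L v ∩ Y).Nonempty ∧ L v ⊆ Y then w v else 0

/-- `Y` can be a part of the cover: no edge leaves it inside the cover, and its gain is at most
`wmax`. It is not required that `Y` becomes connected. -/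
def Good (L : V → Finset V) (w : V → ℤ) (C : Finset V) (wmax : ℤ) (Y : Finset V) : Prop :=
  (∀ v ∈ C, (L v ∩ Y).Nonempty → L v ⊆ Y) ∧ gain L w Y ≤ wmax

/-- `𝒬` is a partition of `X` into good parts. -/
structure IsGoodPartition (L : V → Finset V) (w : V → ℤ) (C : Finset V) (wmax : ℤ)
    (X : Finset V) (𝒬 : Finset (Finset V)) : Prop where
  nonempty : ∀ Y ∈ 𝒬, Y.Nonempty
  good : ∀ Y ∈ 𝒬, Good L w C wmax Y
  disjoint : ∀ Y ∈ 𝒬, ∀ Z ∈ 𝒬, Y ≠ Z → Disjoint Y Z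
  union : 𝒬.biUnion id = X

/-- The set that a partition `𝒬` of the cover prescribes: the vertices with a nonempty trace that
is not contained in one part. -/
def separator (L : V → Finset V) (𝒬 : Finset (Finset V)) : Set V :=
  {v | (L v).Nonempty ∧ ∀ Y ∈ 𝒬, ¬ L v ⊆ Y}

open Classical in
/-- The total weight of the vertices with an empty trace, that is, of the isolated vertices outside
the cover. -/
noncomputable def isoWeight (L : V → Finset V) (w : V → ℤ) : ℤ :=
  ∑ v, if L v = ∅ then w v else 0

open Classical in
theorem gain_eq_weight (L : V → Finset V) (w : V → ℤ) (Y : Finset V) :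
    gain L w Y = weight w {v | (L v ∩ Y).Nonempty ∧ L v ⊆ Y} := by
  simp [gain, weight, Set.indicator_apply]

section

variable {G : SimpleGraph V} {C : Finset V} {w : V → ℤ} {wmax : ℤ}

/-- Adjacent kept vertices with a nonempty trace have their traces in the same part, because one of
the two vertices lies in both traces. -/
theorem trace_subset_of_adj (hC : G.IsVertexCover (C : Set V)) {𝒬 : Finset (Finset V)}
    (h𝒬 : IsGoodPartition (trace G C) w C wmax C 𝒬) {x y : V}
    (hy : y ∉ separator (trace G C) 𝒬) (hxy : G.Adj x y) {Y : Finset V} (hY : Y ∈ 𝒬)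
    (hxY : trace G C x ⊆ Y) : trace G C y ⊆ Y := by
  obtain ⟨z, hzx, hzy⟩ : ∃ z, z ∈ trace G C x ∧ z ∈ trace G C y := by
    rcases hC hxy with h | h
    · exact ⟨x, self_mem_trace h, mem_trace.2 ⟨h, Or.inr hxy.symm⟩⟩
    · exact ⟨y, mem_trace.2 ⟨h, Or.inr hxy⟩, self_mem_trace h⟩
  have : ∃ Z ∈ 𝒬, trace G C y ⊆ Z := by
    by_contra! hcon
    exact hy ⟨⟨z, hzy⟩, hcon⟩
  obtain ⟨Z, hZ, hyZ⟩ := this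
  by_cases hne : Y = Z
  · exact hne ▸ hyZ
  · exact absurd (hyZ hzy) (Finset.disjoint_left.1 (h𝒬.disjoint Y hY Z hZ hne) (hxY hzx))

theorem IsGoodPartition.exists_part {L : V → Finset V} {X : Finset V} {𝒬 : Finset (Finset V)}
    (h𝒬 : IsGoodPartition L w C wmax X 𝒬) {u : V} (hu : u ∈ X) : ∃ Y ∈ 𝒬, u ∈ Y := by
  rw [← h𝒬.union] at hu
  simpa using hu

theorem IsGoodPartition.trace_subset_part {𝒬 : Finset (Finset V)}
    (h𝒬 : IsGoodPartition (trace G C) w C wmax C 𝒬) {u : V} (hu : u ∈ C) {Y : Finset V}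
    (hY : Y ∈ 𝒬) (huY : u ∈ Y) : trace G C u ⊆ Y :=
  (h𝒬.good Y hY).1 u hu ⟨u, Finset.mem_inter.2 ⟨self_mem_trace hu, huY⟩⟩

/-- The set prescribed by a good partition is feasible. -/
theorem feasible_separator (hw : ∀ v, 0 < w v) (hC : G.IsVertexCover (C : Set V))
    {𝒬 : Finset (Finset V)} (h𝒬 : IsGoodPartition (trace G C) w C wmax C 𝒬)
    (hiso : ∀ v, trace G C v = ∅ → w v ≤ wmax) :
    separator (trace G C) 𝒬 ⊆ (C : Set V)ᶜ ∧ Irredundant G (separator (trace G C) 𝒬) ∧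
      ∀ D ∈ cc G (separator (trace G C) 𝒬), weight w D ≤ wmax := by
  set S := separator (trace G C) 𝒬 with hS
  have hsub : S ⊆ (C : Set V)ᶜ := by
    intro v hv hvC
    obtain ⟨Y, hY, hvY⟩ := h𝒬.exists_part hvC
    exact hv.2 Y hY (h𝒬.trace_subset_part hvC hY hvY)
  refine ⟨hsub, ?_, ?_⟩
  · rintro v ⟨hv, hsing⟩
    obtain ⟨u, hu⟩ := hv.1
    have huC := trace_subset hu
    obtain ⟨Y, hY, huY⟩ := h𝒬.exists_part huC
    obtain ⟨u', hu', hu'Y⟩ := Finset.not_subset.1 (hv.2 Y hY)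
    have hu'C := trace_subset hu'
    have hadj : ∀ z ∈ trace G C v, G.Adj v z := by
      intro z hz
      rcases (mem_trace.1 hz).2 with rfl | h
      · exact absurd (trace_subset hz) (hsub hv)
      · exact h
    obtain ⟨D, hD, huD⟩ := exists_mem_cc (G := G) (S := S) (fun h => hsub h huC)
    obtain ⟨D', hD', hu'D'⟩ := exists_mem_cc (G := G) (S := S) (fun h => hsub h hu'C)
    have heq : D = D' := hsing ⟨hD, u, huD, hadj u hu⟩ ⟨hD', u', hu'D', hadj u' hu'⟩
    subst heq
    have := mem_of_mem_cc hD (P := fun z => trace G C z ⊆ Y)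
      (fun a b _ hb hab ha => trace_subset_of_adj hC h𝒬 hb hab hY ha) huD hu'D'
      (h𝒬.trace_subset_part huC hY huY)
    exact hu'Y (this (self_mem_trace hu'C))
  · intro D hD
    by_cases hex : ∃ x ∈ D, (trace G C x).Nonempty
    · obtain ⟨x, hx, hxne⟩ := hex
      have hxS := not_mem_of_mem_cc hD hx
      obtain ⟨Y, hY, hxY⟩ : ∃ Y ∈ 𝒬, trace G C x ⊆ Y := by
        by_contra! hcon
        exact hxS ⟨hxne, hcon⟩
      refine le_trans ?_ (h𝒬.good Y hY).2
      rw [gain_eq_weight]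
      refine weight_mono hw fun y hy => ?_
      have key := mem_of_mem_cc hD (P := fun z => (trace G C z).Nonempty ∧ trace G C z ⊆ Y)
        (fun a b _ hb hab ha => ⟨?_, trace_subset_of_adj hC h𝒬 hb hab hY ha.2⟩) hx hy ⟨hxne, hxY⟩
      · exact ⟨by rw [Finset.inter_eq_left.2 key.2]; exact key.1, key.2⟩
      · rw [Finset.nonempty_iff_ne_empty, Ne, trace_eq_empty_iff hC]
        exact fun h => h.2 a hab.symm
    · push Not at hex
      have hempty : ∀ x ∈ D, trace G C x = ∅ := fun x hx => by simpa using hex x hx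
      rcases D.eq_empty_or_nonempty with rfl | ⟨x, hx⟩
      · obtain ⟨K, hK⟩ := hD
        exact absurd hK.symm (by simpa using K.nonempty_supp.ne_empty)
      · have : D ⊆ {x} := fun y hy =>
          mem_of_mem_cc hD (P := fun z => z = x)
            (fun a b _ _ hab ha =>
              absurd hab (by rw [ha]; exact ((trace_eq_empty_iff hC).1 (hempty x hx)).2 b))
            hx hy rfl
        refine (weight_mono hw this).trans ?_
        rw [weight_singleton]
        exact hiso x (hempty x hx)

/-- Every vertex with a nonempty trace is either in the prescribed set or counted by exactly one
part, so that a light set corresponds to a large total gain. -/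
theorem weight_separator {L : V → Finset V} {𝒬 : Finset (Finset V)}
    (h𝒬 : IsGoodPartition L w C wmax C 𝒬) :
    weight w (separator L 𝒬) = ∑ v, w v - isoWeight L w - ∑ Y ∈ 𝒬, gain L w Y := by
  classical
  unfold weight isoWeight gain
  rw [Finset.sum_comm, ← Finset.sum_sub_distrib, ← Finset.sum_sub_distrib]
  refine Finset.sum_congr rfl fun v _ => ?_
  by_cases h0 : L v = ∅
  · simp [h0, separator]
  have hne := Finset.nonempty_iff_ne_empty.2 h0
  by_cases hex : ∃ Y ∈ 𝒬, L v ⊆ Y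
  · obtain ⟨Y, hY, hvY⟩ := hex
    have hS : v ∉ separator L 𝒬 := fun h => h.2 Y hY hvY
    rw [Finset.sum_eq_single_of_mem Y hY]
    · simp [h0, hS, hvY, Finset.inter_eq_left.2 hvY, hne]
    · intro Z hZ hZY
      rw [if_neg]
      rintro ⟨-, hvZ⟩
      obtain ⟨u, hu⟩ := hne
      exact Finset.disjoint_left.1 (h𝒬.disjoint Z hZ Y hY hZY) (hvZ hu) (hvY hu)
  · push Not at hex
    have hS : v ∈ separator L 𝒬 := ⟨hne, hex⟩
    rw [Finset.sum_eq_zero]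
    · simp [h0, hS]
    · intro Z hZ
      rw [if_neg]
      exact fun h => hex Z hZ h.2

/-- The components of a feasible set induce a good partition of the cover whose total gain is at
least the weight that is kept. -/
theorem exists_partition_of_feasible (hw : ∀ v, 0 < w v) (hC : G.IsVertexCover (C : Set V))
    {S : Set V} (hSC : S ⊆ (C : Set V)ᶜ) (hirr : Irredundant G S)
    (hcc : ∀ D ∈ cc G S, weight w D ≤ wmax) :
    (∀ v, trace G C v = ∅ → w v ≤ wmax) ∧ ∃ 𝒬, IsGoodPartition (trace G C) w C wmax C 𝒬 ∧
      ∑ v, w v - isoWeight (trace G C) w - ∑ Y ∈ 𝒬, gain (trace G C) w Y ≤ weight w S := by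
  classical
  have hCS : ∀ {u}, u ∈ C → u ∉ S := fun hu h => hSC h hu
  have hadj : ∀ {v}, v ∈ S → ∀ {z}, z ∈ trace G C v → G.Adj v z := by
    intro v hv z hz
    rcases (mem_trace.1 hz).2 with rfl | h
    · exact absurd (trace_subset hz) (hSC hv)
    · exact h
  -- A kept vertex lies in a component together with its whole trace.
  have htr : ∀ {D}, D ∈ cc G S → ∀ {v u}, v ∉ S → u ∈ trace G C v → (v ∈ D ↔ u ∈ D) := by
    intro D hD v u hv hu
    rcases (mem_trace.1 hu).2 with rfl | h
    · rfl
    · exact ⟨fun h' => mem_cc_of_adj hD h' (hCS (trace_subset hu)) h,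
        fun h' => mem_cc_of_adj hD h' hv h.symm⟩
  -- A deleted vertex has neighbours in two components.
  have hred : ∀ {D}, D ∈ cc G S → ∀ {v}, v ∈ S → ¬ (∀ u ∈ trace G C v, u ∈ D) := by
    intro D hD v hv hall
    refine hirr v ⟨hv, ?_⟩
    have aux : ∀ D' ∈ {D' ∈ cc G S | ∃ u ∈ D', G.Adj v u}, D' = D := by
      rintro D' ⟨hD', u, huD', huv⟩
      have huC : u ∈ C := (hC huv).resolve_left (hSC hv)
      exact cc_eq_of_mem hD' hD huD' (hall u (mem_trace.2 ⟨huC, Or.inr huv⟩))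
    intro D₁ h₁ D₂ h₂
    rw [aux _ h₁, aux _ h₂]
  constructor
  · intro v hv
    have hvS : v ∉ S := by
      intro h
      refine hirr v ⟨h, ?_⟩
      rintro D ⟨-, u, -, hu⟩
      exact absurd hu (((trace_eq_empty_iff hC).1 hv).2 u)
    obtain ⟨D, hD, hvD⟩ := exists_mem_cc (G := G) hvS
    refine le_trans ?_ (hcc D hD)
    rw [← weight_singleton (w := w) (v := v)]
    exact weight_mono hw (by simpa using hvD)
  -- The parts are the nonempty traces of the components on the cover.
  have hpart : ∀ D ∈ cc G S, Good (trace G C) w C wmax (C.filter (· ∈ D)) := by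
    intro D hD
    constructor
    · rintro v hv ⟨u, hu⟩
      simp only [Finset.mem_inter, Finset.mem_filter] at hu
      have hvD := (htr hD (hCS hv) hu.1).2 hu.2.2
      intro z hz
      exact Finset.mem_filter.2 ⟨trace_subset hz, (htr hD (hCS hv) hz).1 hvD⟩
    · refine le_trans ?_ (hcc D hD)
      rw [gain_eq_weight]
      refine weight_mono hw ?_
      rintro v ⟨⟨u, hu⟩, hsub⟩
      simp only [Finset.mem_inter, Finset.mem_filter] at hu
      have hvS : v ∉ S := fun h => hred hD h fun z hz => (Finset.mem_filter.1 (hsub hz)).2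
      exact (htr hD hvS hu.1).2 hu.2.2
  refine ⟨(C.powerset.filter fun Y => Y.Nonempty ∧ ∃ D ∈ cc G S, Y = C.filter (· ∈ D)), ?_, ?_⟩
  · refine ⟨?_, ?_, ?_, ?_⟩
    · intro Y hY
      exact (Finset.mem_filter.1 hY).2.1
    · intro Y hY
      obtain ⟨-, -, D, hD, rfl⟩ := Finset.mem_filter.1 hY
      exact hpart D hD
    · intro Y hY Z hZ hne
      obtain ⟨-, -, D, hD, rfl⟩ := Finset.mem_filter.1 hY
      obtain ⟨-, -, D', hD', rfl⟩ := Finset.mem_filter.1 hZ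
      rw [Finset.disjoint_left]
      intro u hu hu'
      rw [Finset.mem_filter] at hu hu'
      exact hne (by rw [cc_eq_of_mem hD hD' hu.2 hu'.2])
    · ext u
      simp only [Finset.mem_biUnion, Finset.mem_filter, Finset.mem_powerset, id]
      constructor
      · rintro ⟨Y, ⟨h, -⟩, hu⟩
        exact h hu
      · intro hu
        obtain ⟨D, hD, huD⟩ := exists_mem_cc (G := G) (hCS hu)
        have hmem : u ∈ C.filter (· ∈ D) := Finset.mem_filter.2 ⟨hu, huD⟩
        exact ⟨_, ⟨Finset.filter_subset _ _, ⟨u, hmem⟩, D, hD, rfl⟩, hmem⟩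
  · set 𝒬 := C.powerset.filter fun Y => Y.Nonempty ∧ ∃ D ∈ cc G S, Y = C.filter (· ∈ D)
    unfold weight isoWeight gain
    rw [Finset.sum_comm, ← Finset.sum_sub_distrib, ← Finset.sum_sub_distrib]
    refine Finset.sum_le_sum fun v _ => ?_
    have hnn : ∀ Y ∈ 𝒬, (0 : ℤ) ≤
        if (trace G C v ∩ Y).Nonempty ∧ trace G C v ⊆ Y then w v else 0 := by
      intro Y _
      split_ifs
      · exact (hw v).le
      · exact le_rfl
    have hsum := Finset.sum_nonneg hnn
    have hwv := hw v
    by_cases hvS : v ∈ S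
    · simp only [hvS, Set.indicator_of_mem]
      split_ifs <;> linarith
    by_cases h0 : trace G C v = ∅
    · simp [h0, hvS]
    obtain ⟨D, hD, hvD⟩ := exists_mem_cc (G := G) hvS
    obtain ⟨u, hu⟩ := Finset.nonempty_iff_ne_empty.2 h0
    have hsub : trace G C v ⊆ C.filter (· ∈ D) := fun z hz =>
      Finset.mem_filter.2 ⟨trace_subset hz, (htr hD hvS hz).1 hvD⟩
    have hmem : C.filter (· ∈ D) ∈ 𝒬 := Finset.mem_filter.2
      ⟨Finset.mem_powerset.2 (Finset.filter_subset _ _), ⟨u, hsub hu⟩, D, hD, rfl⟩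
    have hle := Finset.single_le_sum hnn hmem
    rw [if_pos ⟨⟨u, Finset.mem_inter.2 ⟨hu, hsub hu⟩⟩, hsub⟩] at hle
    simp only [hvS, h0, not_false_eq_true, Set.indicator_of_notMem, if_false]
    linarith

end

end Partition

/-! ### Reasoning about programs -/

/-- The program `p`, started in `s`, halts within `T` steps in a state that satisfies `Q`. -/
def Runs (p : Program) (s : State) (T : ℕ) (Q : State → Prop) : Prop :=
  ∃ t s', Exec p s t s' ∧ t ≤ T ∧ Q s'

/-- The weakest precondition of a loop-free program. Loops are handled by `Runs.whilePos`; here they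
get the precondition `False`. Since loads and stores require a nonnegative address, `Int.toNat` is
exact where it is used. -/
def wp : Program → (State → Prop) → State → Prop
  | .skip, Q, s => Q s
  | .const r z, Q, s => Q (s.setReg r z)
  | .move r a, Q, s => Q (s.setReg r (s.reg a))
  | .add r a b, Q, s => Q (s.setReg r (s.reg a + s.reg b))
  | .sub r a b, Q, s => Q (s.setReg r (s.reg a - s.reg b))
  | .load r a, Q, s => 0 ≤ s.reg a ∧ Q (s.setReg r (s.mem (s.reg a).toNat))
  | .store a r, Q, s => 0 ≤ s.reg a ∧ Q (s.setMem (s.reg a).toNat (s.reg r))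
  | .seq p q, Q, s => wp p (wp q Q) s
  | .ifPos r p q, Q, s => (0 < s.reg r → wp p Q s) ∧ (s.reg r ≤ 0 → wp q Q s)
  | .whilePos _ _, _, _ => False

/-- An upper bound for the number of steps of a loop-free program. The value at loops is
meaningless. -/
def cost : Program → ℕ
  | .seq p q => cost p + cost q
  | .ifPos _ p q => max (cost p) (cost q) + 1
  | _ => 1

theorem Runs.mono {p : Program} {s : State} {T T' : ℕ} {Q Q' : State → Prop}
    (h : Runs p s T Q) (hT : T ≤ T') (hQ : ∀ σ, Q σ → Q' σ) : Runs p s T' Q' := by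
  obtain ⟨t, s', h1, h2, h3⟩ := h
  exact ⟨t, s', h1, h2.trans hT, hQ _ h3⟩

theorem Runs.seq {p q : Program} {s : State} {T₁ T₂ : ℕ} {Q R : State → Prop}
    (hp : Runs p s T₁ R) (hq : ∀ σ, R σ → Runs q σ T₂ Q) : Runs (.seq p q) s (T₁ + T₂) Q := by
  obtain ⟨t, s', h1, h2, h3⟩ := hp
  obtain ⟨t', s'', h1', h2', h3'⟩ := hq _ h3
  exact ⟨_, _, .seq _ _ _ _ _ _ _ h1 h1', add_le_add h2 h2', h3'⟩

theorem Runs.ifPos {p q : Program} {r : ℕ} {s : State} {T : ℕ} {Q : State → Prop}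
    (hp : 0 < s.reg r → Runs p s T Q) (hq : s.reg r ≤ 0 → Runs q s T Q) :
    Runs (.ifPos r p q) s (T + 1) Q := by
  by_cases h : 0 < s.reg r
  · obtain ⟨t, s', h1, h2, h3⟩ := hp h
    exact ⟨_, _, .ifTrue _ _ _ _ _ _ h h1, Nat.succ_le_succ h2, h3⟩
  · obtain ⟨t, s', h1, h2, h3⟩ := hq (not_lt.1 h)
    exact ⟨_, _, .ifFalse _ _ _ _ _ _ h h1, Nat.succ_le_succ h2, h3⟩

theorem Runs.of_wp {p : Program} {s : State} {Q : State → Prop} (h : wp p Q s) :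
    Runs p s (cost p) Q := by
  induction p generalizing s Q with
  | skip => exact ⟨_, _, .skip _, le_rfl, h⟩
  | const => exact ⟨_, _, .const _ _ _, le_rfl, h⟩
  | move => exact ⟨_, _, .move _ _ _, le_rfl, h⟩
  | add => exact ⟨_, _, .add _ _ _ _, le_rfl, h⟩
  | sub => exact ⟨_, _, .sub _ _ _ _, le_rfl, h⟩
  | load r a => exact ⟨_, _, .load _ _ _ _ (Int.toNat_of_nonneg h.1).symm, le_rfl, h.2⟩
  | store a r => exact ⟨_, _, .store _ _ _ _ (Int.toNat_of_nonneg h.1).symm, le_rfl, h.2⟩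
  | seq p q ihp ihq => exact (ihp h).seq fun σ hσ => ihq hσ
  | ifPos r p q ihp ihq =>
    exact Runs.ifPos (fun h' => (ihp (h.1 h')).mono (le_max_left _ _) fun _ => id)
      (fun h' => (ihq (h.2 h')).mono (le_max_right _ _) fun _ => id)
  | whilePos => exact h.elim

/-- A loop whose test register decreases in every round. -/
theorem Runs.whilePos {r : ℕ} {p : Program} {s : State} {T : ℕ} {Q : State → Prop}
    (Inv : State → Prop) (h0 : Inv s)
    (hbody : ∀ σ, Inv σ → 0 < σ.reg r → Runs p σ T fun σ' => Inv σ' ∧ σ'.reg r < σ.reg r)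
    (hQ : ∀ σ, Inv σ → σ.reg r ≤ 0 → Q σ) (m : ℕ) (hm : s.reg r ≤ m) :
    Runs (.whilePos r p) s (m * (T + 1) + 1) Q := by
  induction m generalizing s with
  | zero =>
    exact ⟨1, s, .whileDone _ _ _ (by simpa using hm), by omega, hQ _ h0 (by simpa using hm)⟩
  | succ m ih =>
    by_cases h : 0 < s.reg r
    · obtain ⟨t, s', h1, h2, h3, h4⟩ := hbody s h0 h
      obtain ⟨t', s'', h1', h2', h3'⟩ := ih h3 (by push_cast at hm; omega)
      refine ⟨_, _, .whileStep _ _ _ _ _ _ _ h h1 h1', ?_, h3'⟩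
      rw [Nat.succ_mul]
      omega
    · exact ⟨1, s, .whileDone _ _ _ h, by omega, hQ _ h0 (not_lt.1 h)⟩

@[simp] theorem State.setReg_mem (s : State) (r : ℕ) (z : ℤ) : (s.setReg r z).mem = s.mem := rfl

@[simp] theorem State.setMem_reg (s : State) (i : ℕ) (z : ℤ) : (s.setMem i z).reg = s.reg := rfl

@[simp] theorem State.setReg_reg (s : State) (r : ℕ) (z : ℤ) (r' : ℕ) :
    (s.setReg r z).reg r' = if r' = r then z else s.reg r' := by
  simp [State.setReg, Function.update_apply]

@[simp] theorem State.setMem_mem (s : State) (i : ℕ) (z : ℤ) (i' : ℕ) :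
    (s.setMem i z).mem i' = if i' = i then z else s.mem i' := by
  simp [State.setMem, Function.update_apply]

/-- The states agree on the memory and on all registers outside `l`. -/
def Frame (l : List ℕ) (s s' : State) : Prop :=
  s'.mem = s.mem ∧ ∀ r, r ∉ l → s'.reg r = s.reg r

/-! ### Codes of sets of cover vertices -/

section Code

variable {n : ℕ} {C X Y : Finset (Fin n)}

/-- `2` to the number of cover vertices below `i`: the place value of vertex `i`. -/
def place (C : Finset (Fin n)) (i : ℕ) : ℕ := 2 ^ {u ∈ C | u.val < i}.card

/-- The part of the code of `Y` that comes from vertices below `i`. -/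
def codeBelow (C Y : Finset (Fin n)) (i : ℕ) : ℕ := ∑ v ∈ Y with v.val < i, place C v

/-- The code of a subset of the cover: its characteristic vector read as a binary number, where
only cover vertices have a digit. -/
def code (C Y : Finset (Fin n)) : ℕ := ∑ v ∈ Y, place C v

theorem filter_lt_succ (Y : Finset (Fin n)) {i : ℕ} (hi : i < n) :
    {u ∈ Y | u.val < i + 1} =
      if ⟨i, hi⟩ ∈ Y then insert ⟨i, hi⟩ {u ∈ Y | u.val < i} else {u ∈ Y | u.val < i} := by
  ext u
  have : u.val = i ↔ u = ⟨i, hi⟩ := by simp [Fin.ext_iff]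
  split_ifs with h <;> simp only [Finset.mem_filter, Finset.mem_insert, Nat.lt_succ_iff_lt_or_eq,
    this] <;> grind

theorem place_succ {i : ℕ} (hi : i < n) :
    place C (i + 1) = if ⟨i, hi⟩ ∈ C then place C i + place C i else place C i := by
  unfold place
  rw [filter_lt_succ C hi]
  split_ifs
  · rw [Finset.card_insert_of_notMem (by simp), pow_succ]
    omega
  · rfl

theorem codeBelow_succ {i : ℕ} (hi : i < n) :
    codeBelow C Y (i + 1) = codeBelow C Y i + if ⟨i, hi⟩ ∈ Y then place C i else 0 := by
  unfold codeBelow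
  rw [filter_lt_succ Y hi]
  split_ifs
  · rw [Finset.sum_insert (by simp), add_comm]
  · rfl

theorem codeBelow_zero : codeBelow C Y 0 = 0 := by simp [codeBelow]

theorem place_zero : place C 0 = 1 := by simp [place]

theorem place_pos (i : ℕ) : 0 < place C i := by unfold place; positivity

theorem place_all : place C n = 2 ^ C.card := by simp [place]

theorem codeBelow_all : codeBelow C Y n = code C Y := by simp [codeBelow, code]

theorem codeBelow_self {i : ℕ} (hi : i ≤ n) : codeBelow C C i + 1 = place C i := by
  induction i with
  | zero => simp [codeBelow_zero, place_zero]
  | succ i ih =>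
    have := ih (by omega)
    rw [codeBelow_succ hi, place_succ hi]
    split_ifs <;> omega

/-- The place value of a cover vertex exceeds every code below it, so that the digits of a code can
be found greedily from the top. -/
theorem codeBelow_lt (hY : Y ⊆ C) {i : ℕ} (hi : i ≤ n) : codeBelow C Y i < place C i := by
  have : codeBelow C Y i ≤ codeBelow C C i :=
    Finset.sum_le_sum_of_subset (Finset.filter_subset_filter _ hY)
  have := codeBelow_self (C := C) hi
  omega

theorem code_lt (hY : Y ⊆ C) : code C Y < 2 ^ C.card := by
  rw [← codeBelow_all, ← place_all]
  exact codeBelow_lt hY le_rfl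

theorem code_self : code C C + 1 = 2 ^ C.card := by
  rw [← codeBelow_all, ← place_all]
  exact codeBelow_self le_rfl

theorem exists_codeBelow {i : ℕ} (hi : i ≤ n) {m : ℕ} (hm : m < place C i) :
    ∃ Y ⊆ C, (∀ v ∈ Y, v.val < i) ∧ code C Y = m := by
  induction i generalizing m with
  | zero =>
    rw [place_zero] at hm
    exact ⟨∅, by simp, by simp, by simp [code]; omega⟩
  | succ i ih =>
    rw [place_succ hi] at hm
    by_cases h : m < place C i
    · obtain ⟨Y, h1, h2, h3⟩ := ih (by omega) h
      exact ⟨Y, h1, fun v hv => (h2 v hv).trans (Nat.lt_succ_self i), h3⟩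
    · split_ifs at hm with hC
      · obtain ⟨Y, h1, h2, h3⟩ := ih (by omega) (m := m - place C i) (by omega)
        refine ⟨insert ⟨i, hi⟩ Y, Finset.insert_subset hC h1, ?_, ?_⟩
        · intro v hv
          rcases Finset.mem_insert.1 hv with rfl | hv
          · simp
          · exact (h2 v hv).trans (Nat.lt_succ_self i)
        · unfold code at h3 ⊢
          rw [Finset.sum_insert (fun h => by simpa using h2 _ h), h3]
          simp only
          omega
      · exact absurd hm h

theorem exists_code {m : ℕ} (hm : m < 2 ^ C.card) : ∃ Y ⊆ C, code C Y = m := by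
  rw [← place_all] at hm
  obtain ⟨Y, h1, -, h3⟩ := exists_codeBelow le_rfl hm
  exact ⟨Y, h1, h3⟩

/-- There are as many subsets of the cover as codes, and every code is attained. -/
theorem code_injective (hX : X ⊆ C) (hY : Y ⊆ C) (h : code C X = code C Y) : X = Y := by
  have := Finset.inj_on_of_surj_on_of_card_le (s := C.powerset) (t := Finset.range (2 ^ C.card))
    (fun Y _ => code C Y) (fun Y hY => by simpa using code_lt (Finset.mem_powerset.1 hY))
    (fun m hm => by
      obtain ⟨Y, h1, h2⟩ := exists_code (Finset.mem_range.1 hm)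
      exact ⟨Y, Finset.mem_powerset.2 h1, h2⟩) (by simp)
  exact this (Finset.mem_powerset.2 hX) (Finset.mem_powerset.2 hY) h

theorem code_sdiff_add (h : Y ⊆ X) : code C (X \ Y) + code C Y = code C X :=
  Finset.sum_sdiff h

theorem code_pos_iff : 0 < code C Y ↔ Y.Nonempty := by
  rw [Nat.pos_iff_ne_zero, Finset.nonempty_iff_ne_empty, ne_eq, not_iff_not]
  simp only [code, Finset.sum_eq_zero_iff, (place_pos _).ne']
  exact ⟨Finset.eq_empty_of_forall_notMem, fun h => by simp [h]⟩

end Code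

/-! ### The program -/

-- Addresses: the weights start at `0`, the place values at `n`, the adjacency matrix at `2 * n`,
-- the values of the dynamic program at `rM = 2 * n + n * n`, and the stored parts at `rM + rK`.
-- Registers: `rV`, `rU`, `rRow` drive the loops over vertices, `rY` and `rX` hold codes of sets,
-- `rRem` and `rRemX` hold what remains of such codes while they are decoded, `rBest` and `rArg`
-- hold the best value found for `rX` and the part that attains it, and `rHit`, `rMiss`, `rBad`,
-- `rOut`, `rOk` are flags, set if positive.
local infixr:60 ";;" => Program.seq
local notation "rN" => (0 : ℕ)
local notation "rWmax" => (1 : ℕ)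
local notation "rOne" => (2 : ℕ)
local notation "rV" => (3 : ℕ)
local notation "rU" => (4 : ℕ)
local notation "rRow" => (5 : ℕ)
local notation "rHit" => (6 : ℕ)
local notation "rMiss" => (7 : ℕ)
local notation "rRem" => (8 : ℕ)
local notation "rP" => (9 : ℕ)
local notation "rA" => (10 : ℕ)
local notation "rE" => (11 : ℕ)
local notation "rY" => (12 : ℕ)
local notation "rX" => (13 : ℕ)
local notation "rK" => (14 : ℕ)
local notation "rM" => (15 : ℕ)
local notation "rGain" => (16 : ℕ)
local notation "rBad" => (17 : ℕ)
local notation "rRemX" => (18 : ℕ)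
local notation "rBest" => (19 : ℕ)
local notation "rArg" => (20 : ℕ)
local notation "rCnt" => (21 : ℕ)
local notation "rOut" => (22 : ℕ)
local notation "rOk" => (23 : ℕ)

/-- One step of `scan`: reads the digit of the next lower vertex. -/
def scanBody : Program :=
  .sub rU rU rOne ;; .add rA rU rN ;; .load rP rA ;;
  .ifPos rP
    (.add rA rRow rU ;; .load rA rA ;; .sub rE rP rRem ;;
      .ifPos rE (.ifPos rA (.const rMiss 1) .skip)
        (.sub rRem rRem rP ;; .ifPos rA (.const rHit 1) .skip))
    .skip

/-- For the vertex whose adjacency row starts at address `rRow` and the set `Y` with code `rY`: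
decides in `rHit` whether the trace of the vertex meets `Y`, and in `rMiss` whether the trace leaves
`Y`. The digits of `rY` are found on the way. -/
def scan : Program :=
  (.const rHit 0 ;; .const rMiss 0 ;; .move rRem rY ;; .move rU rN) ;; .whilePos rU scanBody

/-- One step of `subset`: reads a digit of both codes. -/
def subsetBody : Program :=
  .sub rU rU rOne ;; .add rA rU rN ;; .load rP rA ;;
  .ifPos rP
    (.sub rA rP rRem ;; .sub rE rP rRemX ;;
      .ifPos rE (.ifPos rA .skip (.const rOut 1 ;; .sub rRem rRem rP))
        (.sub rRemX rRemX rP ;; .ifPos rA .skip (.sub rRem rRem rP)))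
    .skip

/-- Decides in `rOut` whether the set with code `rY` has an element outside the set with code
`rX`. -/
def subset : Program :=
  (.const rOut 0 ;; .move rRem rY ;; .move rRemX rX ;; .move rU rN) ;; .whilePos rU subsetBody

/-- Runs `p` for all vertices, in descending order, with the vertex in `rV` and the address of its
adjacency row in `rRow`. -/
def forVertices (p : Program) : Program :=
  (.move rV rN ;; .move rRow rM) ;;
    .whilePos rV ((.sub rV rV rOne ;; .sub rRow rRow rN) ;; p)

/-- Accounts in `eval` for the vertex that has just been scanned. -/
def evalTail : Program :=
  .ifPos rHit
    (.ifPos rMiss (.add rA rV rN ;; .load rP rA ;; .ifPos rP (.const rBad 1) .skip)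
      (.load rA rV ;; .add rGain rGain rA))
    .skip

/-- Computes in `rGain` the gain of the set with code `rY`, and decides in `rBad` whether the set
fails to be good. -/
def eval : Program :=
  (.const rGain 0 ;; .const rBad 0) ;; forVertices (scan ;; evalTail) ;;
    (.sub rE rGain rWmax ;; .ifPos rE (.const rBad 1) .skip)

/-- Compares the split of `rX` into `rY` and the rest with the best split so far. The comparison
adds one because a value is valid if it is at least `0`. -/
def relaxTail : Program :=
  .ifPos rOut .skip (.ifPos rBad .skip
    (.sub rA rX rY ;; .add rA rM rA ;; .load rA rA ;; .add rE rA rOne ;;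
      .ifPos rE
        (.add rA rA rGain ;; .sub rE rA rBest ;;
          .ifPos rE (.move rBest rA ;; .move rArg rY) .skip)
        .skip)) ;;
  .sub rY rY rOne

/-- One round of the inner loop of the dynamic program: tries `rY` as the code of a part of the set
with code `rX`. -/
def relax : Program := subset ;; eval ;; relaxTail

/-- Computes the table entries for the next code, `rX + 1`. -/
def tableBody : Program :=
  (.sub rCnt rCnt rOne ;; .add rX rX rOne ;; .const rBest (-1) ;; .const rArg 0 ;; .move rY rX) ;;
    .whilePos rY relax ;;
    (.add rA rM rX ;; .store rA rBest ;; .add rA rA rK ;; .store rA rArg)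

/-- The dynamic program over the codes of all subsets of the cover. Cell `rM + x` receives the
largest total gain of a good partition of the set with code `x` (`-1` if there is none), and cell
`rM + rK + x` the code of a part of an optimal partition. -/
def table : Program :=
  (.const rX 0 ;; .const rA 0 ;; .store rM rA ;; .sub rCnt rK rOne) ;; .whilePos rCnt tableBody

/-- One step of `prepare`, with the next vertex in ascending order. -/
def prepareBody : Program :=
  .sub rV rV rOne ;; .add rM rM rN ;; .load rP rA ;; .store rRow rOne ;; .add rRow rRow rN ;;
    .add rRow rRow rOne ;;
    .ifPos rP (.store rA rK ;; .add rK rK rK) .skip ;; .add rA rA rOne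

/-- Computes `2 * n + n * n` in `rM`, replaces the indicator of the cover by the place values,
writes ones on the diagonal of the adjacency matrix, and computes in `rK` the number of subsets of
the cover. -/
def prepare : Program :=
  (.const rOne 1 ;; .add rM rN rN ;; .move rRow rM ;; .const rK 1 ;; .move rV rN ;; .move rA rN) ;;
    .whilePos rV prepareBody

/-- Treats in `isolated` the vertex that has just been scanned. -/
def isoTail : Program :=
  .ifPos rHit (.store rV rOne)
    (.load rA rV ;; .sub rE rA rWmax ;; .ifPos rE (.const rOk 0) .skip ;;
      .const rA 0 ;; .store rV rA)

/-- Overwrites the weights by the indicator of the vertices with a nonempty trace, and clears `rOk`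
if a vertex with an empty trace is too heavy. -/
def isolated : Program := .move rY rX ;; forVertices (scan ;; isoTail)

/-- Removes the vertex that has just been scanned from the output if its trace is contained in the
part. -/
def markTail : Program :=
  .ifPos rHit (.ifPos rMiss .skip (.const rA 0 ;; .store rV rA)) .skip

/-- Splits off the stored part from the set with code `rX`. -/
def outputBody : Program :=
  (.add rA rM rX ;; .add rA rA rK ;; .load rY rA) ;; forVertices (scan ;; markTail) ;;
    .sub rX rX rY

/-- Follows the stored parts of an optimal partition of the cover and removes from the output the
vertices whose trace lies in one part. -/
def output : Program := .whilePos rX outputBody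

/-- The whole program. Register `rOk` is positive if the cover has a good partition and no vertex
with an empty trace is too heavy. -/
def solve : Program :=
  prepare ;; table ;; (.add rA rM rX ;; .load rE rA ;; .add rOk rE rOne) ;; isolated ;;
    .ifPos rOk (output ;; .const rN 1) (.const rN 0)

/-! ### Subroutines -/

variable {I : Input}

/-- The trace of a vertex of the input on its cover. -/
noncomputable abbrev Input.tr (I : Input) (v : Fin I.n) : Finset (Fin I.n) := trace I.G I.C v

open Classical in
/-- The machine has been prepared: memory holds the place values of the cover vertices and the
adjacency matrix with ones on the diagonal. -/
structure Ready (I : Input) (s : State) : Prop where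
  n : s.reg rN = I.n
  wmax : s.reg rWmax = I.wmax
  one : s.reg rOne = 1
  K : s.reg rK = (2 ^ I.C.card : ℕ)
  M : s.reg rM = (2 * I.n + I.n * I.n : ℕ)
  place : ∀ v : Fin I.n, s.mem (I.n + v) = if v ∈ I.C then (place I.C v : ℤ) else 0
  adj : ∀ v u : Fin I.n,
    s.mem (2 * I.n + I.n * v + u) = if u = v ∨ I.G.Adj v u then 1 else 0

theorem Ready.frame {s s' : State} (h : Ready I s) {l : List ℕ} (hf : Frame l s s')
    (hl : ∀ r ∈ [rN, rWmax, rOne, rK, rM], r ∉ l) : Ready I s' := by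
  simp only [List.mem_cons, List.not_mem_nil, or_false, forall_eq_or_imp, forall_eq] at hl
  obtain ⟨h0, h1, h2, h3, h4⟩ := hl
  constructor
  · rw [hf.2 _ h0, h.n]
  · rw [hf.2 _ h1, h.wmax]
  · rw [hf.2 _ h2, h.one]
  · rw [hf.2 _ h3, h.K]
  · rw [hf.2 _ h4, h.M]
  · rw [hf.1]; exact h.place
  · rw [hf.1]; exact h.adj

/-- The scan of the row of `v`, started in `s`, has reached vertex `i` from above. -/
structure ScanInv (I : Input) (v : Fin I.n) (Y : Finset (Fin I.n)) (s : State) (i : ℕ) (σ : State) :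
    Prop where
  le : i ≤ I.n
  u : σ.reg rU = i
  rem : σ.reg rRem = codeBelow I.C Y i
  frame : Frame [rU, rHit, rMiss, rRem, rP, rA, rE] s σ
  hit : 0 < σ.reg rHit ↔ ∃ u ∈ I.tr v, u ∈ Y ∧ i ≤ u.val
  miss : 0 < σ.reg rMiss ↔ ∃ u ∈ I.tr v, u ∉ Y ∧ i ≤ u.val

theorem exists_le_iff {n i : ℕ} (hi : i < n) {P Q : Fin n → Prop} :
    (∃ u, P u ∧ Q u ∧ i ≤ u.val) ↔
      (∃ u, P u ∧ Q u ∧ i + 1 ≤ u.val) ∨ P ⟨i, hi⟩ ∧ Q ⟨i, hi⟩ := by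
  constructor
  · rintro ⟨u, h1, h2, h3⟩
    rcases h3.lt_or_eq with h | rfl
    · exact Or.inl ⟨u, h1, h2, h⟩
    · exact Or.inr ⟨h1, h2⟩
  · rintro (⟨u, h1, h2, h3⟩ | ⟨h1, h2⟩)
    · exact ⟨u, h1, h2, by omega⟩
    · exact ⟨_, h1, h2, le_rfl⟩

theorem Frame.trans {l : List ℕ} {s σ σ' : State} (h : Frame l s σ) (h' : Frame l σ σ') :
    Frame l s σ' :=
  ⟨h'.1.trans h.1, fun r hr => (h'.2 r hr).trans (h.2 r hr)⟩

theorem Frame.mono {l l' : List ℕ} {s σ : State} (h : Frame l s σ) (hl : l ⊆ l') : Frame l' s σ :=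
  ⟨h.1, fun r hr => h.2 r fun hr' => hr (hl hr')⟩

theorem Frame.refl {l : List ℕ} {s : State} : Frame l s s := ⟨rfl, fun _ _ => rfl⟩

theorem Frame.setReg {l : List ℕ} {s σ : State} {r : ℕ} {z : ℤ} (h : Frame l s σ) (hr : r ∈ l) :
    Frame l s (σ.setReg r z) := by
  refine ⟨h.1, fun r' hr' => ?_⟩
  rw [State.setReg_reg, if_neg (by rintro rfl; exact hr' hr), h.2 r' hr']

theorem runs_scanBody {s σ : State} {v : Fin I.n} {Y : Finset (Fin I.n)} {i : ℕ} (hs : Ready I s)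
    (hrow : s.reg rRow = (2 * I.n + I.n * v : ℕ)) (hY : Y ⊆ I.C)
    (h : ScanInv I v Y s (i + 1) σ) : Runs scanBody σ 12 (ScanInv I v Y s i) := by
  have hi : i < I.n := h.le
  have hσ : Ready I σ := hs.frame h.frame (by simp)
  have hrow' : σ.reg rRow = 2 * I.n + I.n * v := by
    rw [h.frame.2 _ (by simp), hrow]; push_cast; rfl
  have hu : σ.reg rU - σ.reg rOne = i := by rw [h.u, hσ.one]; simp
  have e1 : ((i : ℤ) + I.n).toNat = I.n + i := by omega
  have e2 : (2 * (I.n : ℤ) + I.n * (v : ℕ) + i).toNat = 2 * I.n + I.n * v + i := by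
    rw [← Int.toNat_natCast (2 * I.n + I.n * v + i)]; push_cast; rfl
  have hp : σ.mem (I.n + i) = _ := hσ.place ⟨i, hi⟩
  have ha : σ.mem (2 * I.n + I.n * v + i) = _ := hσ.adj v ⟨i, hi⟩
  have hrem := h.rem
  have hsucc := codeBelow_succ (C := I.C) (Y := Y) hi
  have hlt := codeBelow_lt hY hi.le
  have hpos := place_pos (C := I.C) i
  have hhit := h.hit
  have hmiss := h.miss
  have htr : (⟨i, hi⟩ : Fin I.n) ∈ I.tr v ↔
      (⟨i, hi⟩ : Fin I.n) ∈ I.C ∧ 0 < σ.mem (2 * I.n + I.n * v + i) := by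
    rw [mem_trace, ha]; split_ifs with h <;> simp [h]
  have hmemY : (⟨i, hi⟩ : Fin I.n) ∈ I.C →
      ((⟨i, hi⟩ : Fin I.n) ∈ Y ↔ place I.C i ≤ codeBelow I.C Y (i + 1)) := by
    intro _
    rw [hsucc]; split_ifs with h <;> simp [h]; omega
  have hC : 0 < σ.mem (I.n + i) ↔ (⟨i, hi⟩ : Fin I.n) ∈ I.C := by
    rw [hp]; split_ifs with h <;> simp [h, hpos]
  have hplace : (⟨i, hi⟩ : Fin I.n) ∈ I.C → σ.mem (I.n + i) = place I.C i := by
    intro h; rw [hp, if_pos h]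
  have hYC := @hY ⟨i, hi⟩
  -- The five cases: the digit of `Y` is zero or one, and `i` is or is not in the row of `v`; or `i`
  -- has no digit.
  refine (Runs.of_wp (p := scanBody) (Q := ScanInv I v Y s i) ?_).mono (by decide) fun _ => id
  simp [scanBody, wp, hu, hσ.n, hrow', h.rem, e1, e2]
  refine ⟨by positivity, fun h1 => ⟨by positivity, fun h2 => ⟨fun h3 => ?_, fun h3 => ?_⟩,
    fun h2 => ⟨fun h3 => ?_, fun h3 => ?_⟩⟩, fun h1 => ?_⟩
  all_goals
    refine ⟨hi.le, by simp, ?_, ?_, ?_, ?_⟩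
    · simp [h.rem]; grind
    · repeat refine Frame.setReg ?_ (by simp)
      exact h.frame
    · rw [exists_le_iff hi]
      simp [hhit]; grind
    · rw [exists_le_iff hi]
      simp [hmiss]; grind

/-- `scan` computes the position of the trace of `v` relative to `Y`. -/
theorem runs_scan {s : State} {v : Fin I.n} {Y : Finset (Fin I.n)} (hs : Ready I s)
    (hrow : s.reg rRow = (2 * I.n + I.n * v : ℕ)) (hY : Y ⊆ I.C) (hYc : s.reg rY = code I.C Y) :
    Runs scan s (13 * I.n + 5) fun σ => Frame [rU, rHit, rMiss, rRem, rP, rA, rE] s σ ∧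
      (0 < σ.reg rHit ↔ (I.tr v ∩ Y).Nonempty) ∧ (0 < σ.reg rMiss ↔ ¬ I.tr v ⊆ Y) := by
  have hinit : Runs (.const rHit 0 ;; .const rMiss 0 ;; .move rRem rY ;; .move rU rN) s 4
      (ScanInv I v Y s I.n) := by
    refine Runs.of_wp ?_
    simp only [wp]
    refine ⟨le_rfl, by simp [hs.n], by simp [hYc, codeBelow_all], ?_, ?_, ?_⟩
    · repeat refine Frame.setReg ?_ (by simp)
      exact Frame.refl
    · simp only [State.setReg_reg]
      simp
    · simp only [State.setReg_reg]
      simp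
  refine (hinit.seq (T₂ := I.n * 13 + 1) fun σ hσ => ?_).mono (by omega) fun _ => id
  refine Runs.whilePos (fun σ => ∃ i, ScanInv I v Y s i σ) ⟨_, hσ⟩ ?_ ?_ _ hσ.u.le
  · rintro σ ⟨i, hi⟩ hpos
    rw [hi.u] at hpos ⊢
    obtain ⟨i, rfl⟩ : ∃ j, i = j + 1 := ⟨i - 1, by omega⟩
    exact (runs_scanBody hs hrow hY hi).mono le_rfl fun σ' h =>
      ⟨⟨i, h⟩, by rw [h.u]; push_cast; omega⟩
  · rintro σ ⟨i, hi⟩ hpos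
    rw [hi.u] at hpos
    obtain rfl : i = 0 := by omega
    refine ⟨hi.frame, ?_, ?_⟩
    · rw [hi.hit]
      simp [Finset.Nonempty]
    · rw [hi.miss]
      simp [Finset.not_subset]

/-- The comparison of two sets, started in `s`, has reached vertex `i` from above. -/
structure SubsetInv (I : Input) (X Y : Finset (Fin I.n)) (s : State) (i : ℕ) (σ : State) :
    Prop where
  le : i ≤ I.n
  u : σ.reg rU = i
  rem : σ.reg rRem = codeBelow I.C Y i
  remX : σ.reg rRemX = codeBelow I.C X i
  frame : Frame [rU, rRem, rRemX, rP, rA, rE, rOut] s σ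
  out : 0 < σ.reg rOut ↔ ∃ u ∈ Y, u ∉ X ∧ i ≤ u.val

theorem runs_subsetBody {s σ : State} {X Y : Finset (Fin I.n)} {i : ℕ} (hs : Ready I s)
    (hX : X ⊆ I.C) (hY : Y ⊆ I.C) (h : SubsetInv I X Y s (i + 1) σ) :
    Runs subsetBody σ 11 (SubsetInv I X Y s i) := by
  have hi : i < I.n := h.le
  have hσ : Ready I σ := hs.frame h.frame (by simp)
  have hu : σ.reg rU - σ.reg rOne = i := by rw [h.u, hσ.one]; simp
  have e1 : ((i : ℤ) + I.n).toNat = I.n + i := by omega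
  have hp : σ.mem (I.n + i) = _ := hσ.place ⟨i, hi⟩
  have hsuccY := codeBelow_succ (C := I.C) (Y := Y) hi
  have hsuccX := codeBelow_succ (C := I.C) (Y := X) hi
  have hltY := codeBelow_lt hY hi.le
  have hltX := codeBelow_lt hX hi.le
  have hpos := place_pos (C := I.C) i
  have hout := h.out
  have hmemY : (⟨i, hi⟩ : Fin I.n) ∈ Y ↔ place I.C i ≤ codeBelow I.C Y (i + 1) := by
    rw [hsuccY]; split_ifs with h <;> simp [h]; omega
  have hmemX : (⟨i, hi⟩ : Fin I.n) ∈ X ↔ place I.C i ≤ codeBelow I.C X (i + 1) := by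
    rw [hsuccX]; split_ifs with h <;> simp [h]; omega
  have hC : 0 < σ.mem (I.n + i) ↔ (⟨i, hi⟩ : Fin I.n) ∈ I.C := by
    rw [hp]; split_ifs with h <;> simp [h, hpos]
  have hplace : (⟨i, hi⟩ : Fin I.n) ∈ I.C → σ.mem (I.n + i) = place I.C i := by
    intro h; rw [hp, if_pos h]
  have hYC := @hY ⟨i, hi⟩
  have hXC := @hX ⟨i, hi⟩
  refine (Runs.of_wp (p := subsetBody) (Q := SubsetInv I X Y s i) ?_).mono (by decide) fun _ => id
  simp [subsetBody, wp, hu, hσ.n, h.rem, h.remX, e1]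
  refine ⟨by positivity, fun h1 => ⟨fun h2 => ⟨fun h3 => ?_, fun h3 => ?_⟩,
    fun h2 => ⟨fun h3 => ?_, fun h3 => ?_⟩⟩, fun h1 => ?_⟩
  all_goals
    refine ⟨hi.le, by simp, ?_, ?_, ?_, ?_⟩
    · simp [h.rem]; grind
    · simp [h.remX]; grind
    · repeat refine Frame.setReg ?_ (by simp)
      exact h.frame
    · rw [exists_le_iff hi]
      simp [hout]; grind

theorem runs_subset {s : State} {X Y : Finset (Fin I.n)} (hs : Ready I s)
    (hX : X ⊆ I.C) (hXc : s.reg rX = code I.C X) (hY : Y ⊆ I.C) (hYc : s.reg rY = code I.C Y) :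
    Runs subset s (12 * I.n + 5) fun σ => Frame [rU, rRem, rRemX, rP, rA, rE, rOut] s σ ∧
      (0 < σ.reg rOut ↔ ¬ Y ⊆ X) := by
  have hinit : Runs (.const rOut 0 ;; .move rRem rY ;; .move rRemX rX ;; .move rU rN) s 4
      (SubsetInv I X Y s I.n) := by
    refine Runs.of_wp ?_
    simp only [wp]
    refine ⟨le_rfl, by simp [hs.n], by simp [hYc, codeBelow_all], by simp [hXc, codeBelow_all],
      ?_, ?_⟩
    · repeat refine Frame.setReg ?_ (by simp)
      exact Frame.refl
    · simp only [State.setReg_reg]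
      simp
  refine (hinit.seq (T₂ := I.n * 12 + 1) fun σ hσ => ?_).mono (by omega) fun _ => id
  refine Runs.whilePos (fun σ => ∃ i, SubsetInv I X Y s i σ) ⟨_, hσ⟩ ?_ ?_ _ hσ.u.le
  · rintro σ ⟨i, hi⟩ hpos
    rw [hi.u] at hpos ⊢
    obtain ⟨i, rfl⟩ : ∃ j, i = j + 1 := ⟨i - 1, by omega⟩
    exact (runs_subsetBody hs hX hY hi).mono le_rfl fun σ' h =>
      ⟨⟨i, h⟩, by rw [h.u]; push_cast; omega⟩
  · rintro σ ⟨i, hi⟩ hpos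
    rw [hi.u] at hpos
    obtain rfl : i = 0 := by omega
    refine ⟨hi.frame, ?_⟩
    rw [hi.out]
    simp [Finset.not_subset]

/-- The invariant `Inv i` says that the vertices from `i` on have been processed; it must not
depend on the registers that drive the loop. -/
theorem runs_forVertices {n : ℕ} {p : Program} {s : State} {T : ℕ} {Q : State → Prop}
    (Inv : ℕ → State → Prop) (hM : s.reg rM = (2 * n + n * n : ℕ))
    (hset : ∀ i σ z z', Inv i σ → Inv i ((σ.setReg rV z).setReg rRow z'))
    (hreg : ∀ i σ, Inv i σ → σ.reg rN = n ∧ σ.reg rOne = 1) (h0 : Inv n s)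
    (hbody : ∀ (v : Fin n) σ, Inv (v + 1) σ → σ.reg rV = v → σ.reg rRow = (2 * n + n * v : ℕ) →
      Runs p σ T fun σ' => Inv v σ' ∧ σ'.reg rV = σ.reg rV ∧ σ'.reg rRow = σ.reg rRow)
    (hQ : ∀ σ, Inv 0 σ → Q σ) : Runs (forVertices p) s (n * (T + 3) + 3) Q := by
  have hinit : Runs (.move rV rN ;; .move rRow rM) s 2 (fun σ => Inv n σ ∧ σ.reg rV = n ∧
      σ.reg rRow = (2 * n + n * n : ℕ)) := by
    refine Runs.of_wp ?_
    simp only [wp]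
    exact ⟨hset _ _ _ _ h0, by simp [(hreg _ _ h0).1], by simp [hM]⟩
  refine (hinit.seq (T₂ := n * (2 + T + 1) + 1) fun σ hσ => ?_).mono
    (by rw [show 2 + T + 1 = T + 3 by ring]; omega) fun _ => id
  refine Runs.whilePos (fun σ => ∃ i ≤ n, Inv i σ ∧ σ.reg rV = i ∧
    σ.reg rRow = (2 * n + n * i : ℕ)) ⟨n, le_rfl, hσ⟩ ?_ ?_ _ hσ.2.1.le
  · rintro σ ⟨i, hin, h1, h2, h3⟩ hpos
    obtain ⟨i, rfl⟩ : ∃ j, i = j + 1 := ⟨i - 1, by omega⟩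
    have hdec : Runs (.sub rV rV rOne ;; .sub rRow rRow rN) σ 2 (fun σ' => Inv (i + 1) σ' ∧
        σ'.reg rV = i ∧ σ'.reg rRow = (2 * n + n * i : ℕ)) := by
      refine Runs.of_wp ?_
      simp only [wp]
      refine ⟨hset _ _ _ _ h1, by simp [(hreg _ _ h1).2, h2], ?_⟩
      simp [(hreg _ _ h1).1, h3]
      ring
    refine hdec.seq fun σ' hσ' => ?_
    refine (hbody ⟨i, hin⟩ σ' hσ'.1 hσ'.2.1 hσ'.2.2).mono le_rfl fun σ'' h => ?_
    rw [h2]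
    exact ⟨⟨i, by omega, h.1, h.2.1.trans hσ'.2.1, h.2.2.trans hσ'.2.2⟩,
      by rw [h.2.1, hσ'.2.1]; push_cast; omega⟩
  · rintro σ ⟨i, hin, h1, h2, h3⟩ hpos
    obtain rfl : i = 0 := by omega
    exact hQ _ h1

theorem sum_ge_succ {n i : ℕ} (hi : i < n) (f : Fin n → ℤ) :
    ∑ v with i ≤ v.val, f v = ∑ v with i + 1 ≤ v.val, f v + f ⟨i, hi⟩ := by
  have : Finset.univ.filter (fun v : Fin n => i ≤ v.val) =
      insert ⟨i, hi⟩ (Finset.univ.filter fun v : Fin n => i + 1 ≤ v.val) := by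
    ext v
    simp [Fin.ext_iff]
    omega
  rw [this, Finset.sum_insert (by simp), add_comm]

/-- The evaluation of a set, started in `s`, has processed the vertices from `i` on. -/
structure EvalInv (I : Input) (Y : Finset (Fin I.n)) (s : State) (i : ℕ) (σ : State) : Prop where
  frame : Frame [rV, rU, rRow, rHit, rMiss, rRem, rP, rA, rE, rGain, rBad] s σ
  gain : σ.reg rGain = ∑ v with i ≤ v.val,
    if (I.tr v ∩ Y).Nonempty ∧ I.tr v ⊆ Y then I.w v else 0
  bad : 0 < σ.reg rBad ↔ ∃ v ∈ I.C, ((I.tr v ∩ Y).Nonempty ∧ ¬ I.tr v ⊆ Y) ∧ i ≤ v.val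

/-- `eval` computes the gain of `Y` and tests whether `Y` is good: no edge leaves `Y` inside the
cover if and only if no trace of a cover vertex meets `Y` without being contained in it. -/
theorem runs_eval {s : State} {Y : Finset (Fin I.n)} (hs : Ready I s)
    (hw : ∀ v : Fin I.n, s.mem v = I.w v) (hY : Y ⊆ I.C) (hYc : s.reg rY = code I.C Y) :
    Runs eval s (I.n * (13 * I.n + 14) + 8) fun σ =>
      Frame [rV, rU, rRow, rHit, rMiss, rRem, rP, rA, rE, rGain, rBad] s σ ∧
        σ.reg rGain = gain I.tr I.w Y ∧ (0 < σ.reg rBad ↔ ¬ Good I.tr I.w I.C I.wmax Y) := by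
  have hinit : Runs (.const rGain 0 ;; .const rBad 0) s 2 (EvalInv I Y s I.n) := by
    refine Runs.of_wp ?_
    simp only [wp]
    refine ⟨?_, ?_, ?_⟩
    · repeat refine Frame.setReg ?_ (by simp)
      exact Frame.refl
    · rw [Finset.sum_eq_zero (fun v hv => absurd (Finset.mem_filter.1 hv).2 (by simp))]
      simp
    · simp only [State.setReg_reg]
      simp
  refine (hinit.seq (T₂ := I.n * (13 * I.n + 5 + 6 + 3) + 3 + 3) fun σ hσ => ?_).mono
    (by rw [show 13 * I.n + 5 + 6 + 3 = 13 * I.n + 14 by ring]; omega) fun _ => id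
  refine Runs.seq (R := EvalInv I Y s 0) ?_ fun σ hσ => ?_
  · refine runs_forVertices (EvalInv I Y s) (hs.frame hσ.frame (by simp)).M ?_ ?_ hσ ?_ fun _ => id
    · rintro i σ z z' ⟨h1, h2, h3⟩
      refine ⟨?_, by simpa using h2, by simpa using h3⟩
      repeat refine Frame.setReg ?_ (by simp)
      exact h1
    · intro i σ h
      exact ⟨(hs.frame h.frame (by simp)).n, (hs.frame h.frame (by simp)).one⟩
    · intro v σ hσ hv hrow
      have hR := hs.frame hσ.frame (by simp)
      refine (runs_scan hR hrow hY ((hσ.frame.2 _ (by simp)).trans hYc)).seq (T₂ := 6) ?_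
      rintro σ' ⟨hf, hhit, hmiss⟩
      have hf' := hσ.frame.trans (hf.mono (by simp))
      have hR' := hs.frame hf' (by simp)
      have hv' : σ'.reg rV = v := (hf.2 _ (by simp)).trans hv
      have hrow' := hf.2 rRow (by simp)
      have hg' : σ'.reg rGain = _ := (hf.2 _ (by simp)).trans hσ.gain
      have hb' := hσ.bad
      rw [← hf.2 rBad (by simp)] at hb'
      have hw' : σ'.mem v = I.w v := by rw [hf'.1]; exact hw v
      have e1 : ((v : ℤ) + I.n).toNat = I.n + v := by omega
      have hp := hR'.place v
      have hC : 0 < σ'.mem (I.n + v) ↔ v ∈ I.C := by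
        rw [hp]; split_ifs with h <;> simp [h, place_pos]
      have hgs := sum_ge_succ v.2 fun v =>
        if (I.tr v ∩ Y).Nonempty ∧ I.tr v ⊆ Y then I.w v else 0
      rw [← hg'] at hgs
      have hbs := exists_le_iff v.2 (P := (· ∈ I.C))
        (Q := fun v => (I.tr v ∩ Y).Nonempty ∧ ¬ I.tr v ⊆ Y)
      rw [← hb'] at hbs
      have hsub : I.tr v ⊆ Y ↔ σ'.reg rMiss ≤ 0 := by rw [← not_lt, hmiss, not_not]
      simp only [Fin.eta, ← hhit, ← hC, hsub, not_le] at hgs hbs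
      refine (Runs.of_wp (p := evalTail) ?_).mono (by decide) fun _ => id
      simp [evalTail, wp, hv', hR'.n, e1]
      refine ⟨fun h1 => ⟨fun h2 => ⟨by positivity, fun h3 => ?_, fun h3 => ?_⟩, fun h2 => ?_⟩,
        fun h1 => ?_⟩
      all_goals
        refine ⟨⟨?_, ?_, ?_⟩, hv.symm, hrow'⟩
        · repeat refine Frame.setReg ?_ (by simp)
          exact hf'
        · rw [hgs]
          first | clear * - h1 h2 hw' | clear * - h1 hw'
          simp [hw']
          grind
        · rw [hbs]
          simp
          grind
  · have hg : σ.reg rGain = WVI.gain I.tr I.w Y := by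
      rw [hσ.gain]
      simp [gain]
    have hR := hs.frame hσ.frame (by simp)
    have hb := hσ.bad
    refine (Runs.of_wp ?_).mono (by decide) fun _ => id
    simp [wp, hg, hR.wmax]
    constructor
    all_goals
      intro h
      refine ⟨?_, ?_⟩
      · repeat refine Frame.setReg ?_ (by simp)
        exact hσ.frame.mono (by simp)
      · simp [Good, hb]
        grind

/-! ### The dynamic program -/

theorem Ready.congr {s s' : State} (h : Ready I s)
    (hr : ∀ r ∈ [rN, rWmax, rOne, rK, rM], s'.reg r = s.reg r)
    (hm : ∀ i, I.n ≤ i → i < 2 * I.n + I.n * I.n → s'.mem i = s.mem i) : Ready I s' := by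
  simp only [List.mem_cons, List.not_mem_nil, or_false, forall_eq_or_imp, forall_eq] at hr
  obtain ⟨h0, h1, h2, h3, h4⟩ := hr
  constructor
  · rw [h0, h.n]
  · rw [h1, h.wmax]
  · rw [h2, h.one]
  · rw [h3, h.K]
  · rw [h4, h.M]
  · intro v
    rw [hm _ (by omega) (by have := v.2; nlinarith), h.place]
  · intro v u
    have h1 := v.2
    have h2 := u.2
    have h3 : I.n * (v + 1) ≤ I.n * I.n := Nat.mul_le_mul_left _ h1
    rw [hm _ (by nlinarith) (by nlinarith), h.adj]

/-- The table entry of the set with code `c`, given the contents of the memory. -/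
def Input.val (I : Input) (mem : ℕ → ℤ) (c : ℕ) : ℤ := mem (2 * I.n + I.n * I.n + c)

/-- The code of the first part that is stored for the set with code `c`. -/
def Input.arg (I : Input) (mem : ℕ → ℤ) (c : ℕ) : ℤ :=
  mem (2 * I.n + I.n * I.n + c + 2 ^ I.C.card)

/-- `Y` can be split off from `X` as a part, and the table has a partition of the rest. -/
structure Splits (I : Input) (mem : ℕ → ℤ) (X Y : Finset (Fin I.n)) : Prop where
  subset : Y ⊆ X
  nonempty : Y.Nonempty
  good : Good I.tr I.w I.C I.wmax Y
  rest : 0 ≤ I.val mem (code I.C (X \ Y))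

/-- The total gain that the split of `X` into `Y` and the rest achieves. -/
noncomputable def splitGain (I : Input) (mem : ℕ → ℤ) (X Y : Finset (Fin I.n)) : ℤ :=
  gain I.tr I.w Y + I.val mem (code I.C (X \ Y))

/-- The table entries of `X` satisfy the recurrence of the dynamic program. -/
structure EntryOK (I : Input) (mem : ℕ → ℤ) (X : Finset (Fin I.n)) : Prop where
  attained : 0 ≤ I.val mem (code I.C X) → ∃ Y, Splits I mem X Y ∧
    I.arg mem (code I.C X) = code I.C Y ∧ I.val mem (code I.C X) = splitGain I mem X Y
  upper : ∀ Y, Splits I mem X Y → splitGain I mem X Y ≤ I.val mem (code I.C X)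

/-- The registers that the dynamic program changes for one set. -/
abbrev relaxRegs : List ℕ :=
  [rV, rU, rRow, rHit, rMiss, rRem, rP, rA, rE, rY, rGain, rBad, rRemX, rBest, rArg, rOut]

/-- For the set `X`, all parts with a code greater than `y` have been tried. -/
structure RelaxInv (I : Input) (X : Finset (Fin I.n)) (s : State) (y : ℕ) (σ : State) : Prop where
  le : y ≤ code I.C X
  Y : σ.reg rY = y
  frame : Frame relaxRegs s σ
  attained : 0 ≤ σ.reg rBest → ∃ Y, Splits I s.mem X Y ∧ σ.reg rArg = code I.C Y ∧
    σ.reg rBest = splitGain I s.mem X Y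
  upper : ∀ Y, Splits I s.mem X Y → y < code I.C Y → splitGain I s.mem X Y ≤ σ.reg rBest

/-- One round of the inner loop reads the gain of `Y` and the value of `X \ Y`, whose address is
found by subtracting the codes. -/
theorem runs_relax {s σ : State} {X : Finset (Fin I.n)} {y : ℕ} (hs : Ready I s)
    (hw : ∀ v : Fin I.n, s.mem v = I.w v) (hX : X ⊆ I.C) (hXc : s.reg rX = code I.C X)
    (h : RelaxInv I X s (y + 1) σ) : Runs relax σ (30 * (I.n + 1) ^ 2) (RelaxInv I X s y) := by
  have hy : y + 1 < 2 ^ I.C.card := h.le.trans_lt (code_lt hX)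
  obtain ⟨Y, hY, hYc⟩ := exists_code hy
  have hσ : Ready I σ := hs.frame h.frame (by simp)
  have hYr : σ.reg rY = code I.C Y := by rw [h.Y, hYc]
  refine Runs.mono (T := (12 * I.n + 5) + ((I.n * (13 * I.n + 14) + 8) + 13)) ?_ (by nlinarith)
    fun _ => id
  refine (runs_subset hσ hX ((h.frame.2 _ (by simp)).trans hXc) hY hYr).seq ?_
  rintro σ₁ ⟨hf₁, hout⟩
  have hF₁ := h.frame.trans (hf₁.mono (by simp))
  refine (runs_eval (hs.frame hF₁ (by simp)) (fun v => by rw [hF₁.1, hw]) hY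
    ((hf₁.2 _ (by simp)).trans hYr)).seq ?_
  rintro σ₂ ⟨hf₂, hgain, hbad⟩
  have hF₂ := hF₁.trans (hf₂.mono (by simp))
  have hR := hs.frame hF₂ (by simp)
  have hY₂ : σ₂.reg rY = y + 1 := by
    rw [hf₂.2 _ (by simp), hf₁.2 _ (by simp), h.Y]; push_cast; rfl
  have hX₂ : σ₂.reg rX = code I.C X := (hF₂.2 _ (by simp)).trans hXc
  have hbest : σ₂.reg rBest = σ.reg rBest := by rw [hf₂.2 _ (by simp), hf₁.2 _ (by simp)]
  have harg : σ₂.reg rArg = σ.reg rArg := by rw [hf₂.2 _ (by simp), hf₁.2 _ (by simp)]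
  rw [← hf₂.2 _ (by simp)] at hout
  have hle := h.le
  have hatt := h.attained
  have hup := h.upper
  rw [← hbest] at hatt hup
  rw [← harg] at hatt
  have e1 : (2 * (I.n : ℤ) + I.n * I.n + (code I.C X - (y + 1))).toNat =
      2 * I.n + I.n * I.n + (code I.C X - (y + 1)) := by
    have : (2 * (I.n : ℤ) + I.n * I.n + (code I.C X - (y + 1))) =
      (2 * I.n + I.n * I.n + (code I.C X - (y + 1)) : ℕ) := by push_cast [h.le]; ring
    rw [this, Int.toNat_natCast]
  -- A split by a part with a code greater than `y` is the split by `Y` or has been tried before.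
  have hcase : ∀ Z, Splits I s.mem X Z → y < code I.C Z → Z = Y ∨ y + 1 < code I.C Z := by
    intro Z hZ hlt
    rcases Nat.lt_or_ge (y + 1) (code I.C Z) with h' | h'
    · exact Or.inr h'
    · exact Or.inl (code_injective (hZ.subset.trans hX) hY (by omega))
  have hne : Y.Nonempty := (code_pos_iff (C := I.C)).1 (by omega)
  have hval : Y ⊆ X → I.val s.mem (code I.C (X \ Y)) =
      s.mem (2 * I.n + I.n * I.n + (code I.C X - (y + 1))) := by
    intro hsub
    have := code_sdiff_add (C := I.C) hsub
    unfold Input.val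
    congr 2
    omega
  have hsg : Y ⊆ X → splitGain I s.mem X Y =
      gain I.tr I.w Y + s.mem (2 * I.n + I.n * I.n + (code I.C X - (y + 1))) := by
    intro hsub
    rw [splitGain, hval hsub]
  have hsplits : Splits I s.mem X Y ↔ Y ⊆ X ∧ Good I.tr I.w I.C I.wmax Y ∧
      0 ≤ s.mem (2 * I.n + I.n * I.n + (code I.C X - (y + 1))) :=
    ⟨fun h => ⟨h.subset, h.good, hval h.subset ▸ h.rest⟩,
      fun h => ⟨h.1, hne, h.2.1, (hval h.1).symm ▸ h.2.2⟩⟩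
  -- The best split so far survives unless the split by `Y` is possible and better.
  have keep : (Splits I s.mem X Y → splitGain I s.mem X Y ≤ σ₂.reg rBest) →
      ∀ σ', Frame relaxRegs s σ' → σ'.reg rY = y → σ'.reg rBest = σ₂.reg rBest →
      σ'.reg rArg = σ₂.reg rArg →
      RelaxInv I X s y σ' := by
    intro hb σ' hf hy hbest' harg'
    refine ⟨by omega, hy, hf, by rwa [hbest', harg'], fun Z hZ hlt => ?_⟩
    rw [hbest']
    rcases hcase Z hZ hlt with rfl | h'
    · exact hb hZ
    · exact hup Z hZ h'
  refine (Runs.of_wp (p := relaxTail) (Q := RelaxInv I X s y) ?_).mono (by decide) fun _ => id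
  simp [relaxTail, wp, hY₂, hX₂, hR.M, hR.one, hgain, e1, hF₂.1]
  refine ⟨fun h1 => ?_, fun h1 => ⟨fun h2 => ?_, fun h2 => ⟨?_, fun h3 => ⟨fun h4 => ?_,
    fun h4 => ?_⟩, fun h3 => ?_⟩⟩⟩
  · refine keep (fun hs => absurd hs.subset (hout.1 h1)) _ ?_ (by simp) (by simp) (by simp)
    repeat refine Frame.setReg ?_ (by simp)
    exact hF₂
  · refine keep (fun hs => absurd hs.good (hbad.1 h2)) _ ?_ (by simp) (by simp) (by simp)
    repeat refine Frame.setReg ?_ (by simp)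
    exact hF₂
  · have : (0 : ℤ) ≤ code I.C X - (y + 1) := by omega
    positivity
  · have hsub : Y ⊆ X := by
      by_contra hcon
      exact absurd (hout.2 hcon) (not_lt.2 h1)
    have hgood : Good I.tr I.w I.C I.wmax Y := by
      by_contra hcon
      exact absurd (hbad.2 hcon) (not_lt.2 h2)
    refine ⟨by omega, by simp, ?_, ?_, ?_⟩
    · repeat refine Frame.setReg ?_ (by simp)
      exact hF₂
    · intro _
      refine ⟨Y, hsplits.2 ⟨hsub, hgood, h3⟩, by simp [hYc], ?_⟩
      rw [hsg hsub]
      simp [add_comm]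
    · intro Z hZ hlt
      simp only [State.setReg_reg]
      rcases hcase Z hZ hlt with rfl | h'
      · rw [hsg hsub]
        simp [add_comm]
      · have := hup Z hZ h'
        simp
        omega
  · refine keep (fun hs => ?_) _ ?_ (by simp) (by simp) (by simp)
    · rw [hsg hs.subset]
      omega
    · repeat refine Frame.setReg ?_ (by simp)
      exact hF₂
  · refine keep (fun hs => ?_) _ ?_ (by simp) (by simp) (by simp)
    · have := (hsplits.1 hs).2.2
      omega
    · repeat refine Frame.setReg ?_ (by simp)
      exact hF₂

/-- All nonempty sets with a code up to `x` have their table entries. The empty set has value `0`,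
and the cells below the table are as in the state `s`. -/
structure TableInv (I : Input) (s : State) (x : ℕ) (σ : State) : Prop where
  lt : x < 2 ^ I.C.card
  X : σ.reg rX = x
  cnt : σ.reg rCnt = (2 ^ I.C.card : ℕ) - 1 - x
  reg : ∀ r, r ∉ rX :: rCnt :: relaxRegs → σ.reg r = s.reg r
  mem : ∀ i < 2 * I.n + I.n * I.n, σ.mem i = s.mem i
  zero : I.val σ.mem 0 = 0
  entry : ∀ X ⊆ I.C, X.Nonempty → code I.C X ≤ x → EntryOK I σ.mem X

theorem TableInv.ready {s σ : State} {x : ℕ} (h : TableInv I s x σ) (hs : Ready I s) :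
    Ready I σ :=
  hs.congr (fun r hr => h.reg r (by revert r; decide)) fun i _ hi => h.mem i hi

/-- An entry depends only on the table cells of the set and of its subsets. -/
theorem EntryOK.congr {mem mem' : ℕ → ℤ} {X : Finset (Fin I.n)} (h : EntryOK I mem X)
    (hval : ∀ c ≤ code I.C X, I.val mem' c = I.val mem c)
    (harg : I.arg mem' (code I.C X) = I.arg mem (code I.C X)) : EntryOK I mem' X := by
  have h1 : ∀ Y, Y ⊆ X → I.val mem' (code I.C (X \ Y)) = I.val mem (code I.C (X \ Y)) :=
    fun Y hY => hval _ (by have := code_sdiff_add (C := I.C) hY; omega)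
  have h2 : ∀ Y, Splits I mem' X Y ↔ Splits I mem X Y := fun Y =>
    ⟨fun h => ⟨h.subset, h.nonempty, h.good, h1 Y h.subset ▸ h.rest⟩,
      fun h => ⟨h.subset, h.nonempty, h.good, (h1 Y h.subset).symm ▸ h.rest⟩⟩
  have h3 : ∀ Y, Y ⊆ X → splitGain I mem' X Y = splitGain I mem X Y := fun Y hY => by
    rw [splitGain, splitGain, h1 Y hY]
  rw [show EntryOK I mem' X ↔ _ from ⟨fun h => And.intro h.1 h.2, fun h => ⟨h.1, h.2⟩⟩]
  rw [hval _ le_rfl, harg]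
  constructor
  · intro h0
    obtain ⟨Y, hY, ha, hv⟩ := h.attained h0
    exact ⟨Y, (h2 Y).2 hY, ha, by rw [h3 Y hY.subset, hv]⟩
  · intro Y hY
    rw [h3 Y hY.subset]
    exact h.upper Y ((h2 Y).1 hY)

theorem runs_tableBody {s σ : State} {x : ℕ} (hs : Ready I s)
    (hw : ∀ v : Fin I.n, s.mem v = I.w v) (h : TableInv I s x σ) (hpos : 0 < σ.reg rCnt) :
    Runs tableBody σ (2 ^ I.C.card * (30 * (I.n + 1) ^ 2 + 1) + 10) (TableInv I s (x + 1)) := by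
  have hx : x + 1 < 2 ^ I.C.card := by
    have := h.cnt
    omega
  obtain ⟨X, hX, hXc⟩ := exists_code hx
  have hσ := h.ready hs
  have hinit : Runs (.sub rCnt rCnt rOne ;; .add rX rX rOne ;; .const rBest (-1) ;;
      .const rArg 0 ;; .move rY rX) σ 5 fun σ₁ => Ready I σ₁ ∧ σ₁.mem = σ.mem ∧
        RelaxInv I X σ₁ (x + 1) σ₁ ∧ σ₁.reg rX = x + 1 ∧
        σ₁.reg rCnt = (2 ^ I.C.card : ℕ) - 1 - (x + 1) ∧
        ∀ r, r ∉ rX :: rCnt :: relaxRegs → σ₁.reg r = s.reg r := by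
    refine Runs.of_wp ?_
    simp only [wp]
    refine ⟨hσ.congr (by simp) (by simp), by simp, ⟨hXc.ge, by simp [h.X, hσ.one], Frame.refl, ?_,
      ?_⟩, by simp [h.X, hσ.one], ?_, ?_⟩
    · simp only [State.setReg_reg]
      simp
    · intro Y hY hlt
      have := code_sdiff_add (C := I.C) hY.subset
      omega
    · simp [h.cnt, hσ.one]
      ring
    · intro r hr
      rw [← h.reg r hr]
      simp only [List.mem_cons, not_or] at hr
      simp [hr]
  refine Runs.mono (T := 5 + ((2 ^ I.C.card * (30 * (I.n + 1) ^ 2 + 1) + 1) + 4)) ?_ (by omega)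
    fun _ => id
  refine hinit.seq ?_
  rintro σ₁ ⟨hR, hm, hinv, hX₁, hcnt, hreg⟩
  have hw₁ : ∀ v : Fin I.n, σ₁.mem v = I.w v := by
    intro v
    rw [hm, h.mem _ (by have := v.2; omega), hw]
  refine Runs.seq (R := RelaxInv I X σ₁ 0) ?_ fun σ₂ h₂ => ?_
  · refine Runs.whilePos (fun σ => ∃ y, RelaxInv I X σ₁ y σ) ⟨_, hinv⟩ ?_ ?_ _ ?_
    · rintro σ ⟨y, hy⟩ hpos
      rw [hy.Y] at hpos ⊢
      obtain ⟨y, rfl⟩ : ∃ j, y = j + 1 := ⟨y - 1, by omega⟩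
      refine (runs_relax hR hw₁ hX ?_ hy).mono le_rfl fun σ' h =>
        ⟨⟨y, h⟩, by rw [h.Y]; push_cast; omega⟩
      rw [hX₁, hXc]
      push_cast
      rfl
    · rintro σ ⟨y, hy⟩ hpos
      rw [hy.Y] at hpos
      obtain rfl : y = 0 := by omega
      exact hy
    · rw [hinv.Y]
      exact_mod_cast hx.le
  · have hR₂ := hR.frame h₂.frame (by simp)
    have hX₂ : σ₂.reg rX = x + 1 := (h₂.frame.2 _ (by simp)).trans hX₁
    have e1 : (2 * (I.n : ℤ) + I.n * I.n + (x + 1)).toNat = 2 * I.n + I.n * I.n + (x + 1) := by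
      rw [← Int.toNat_natCast (2 * I.n + I.n * I.n + (x + 1))]; push_cast; rfl
    have e2 : (2 * (I.n : ℤ) + I.n * I.n + (x + 1) + 2 ^ I.C.card).toNat =
        2 * I.n + I.n * I.n + (x + 1) + 2 ^ I.C.card := by
      rw [← Int.toNat_natCast (2 * I.n + I.n * I.n + (x + 1) + 2 ^ I.C.card)]; push_cast; rfl
    have hm₂ : σ₂.mem = σ.mem := h₂.frame.1.trans hm
    refine (Runs.of_wp ?_).mono (by decide) fun _ => id
    simp [wp, hX₂, hR₂.M, hR₂.K, e1, e2]
    refine ⟨by positivity, by positivity, ?_⟩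
    set mem' := (((((σ₂.setReg 10 (2 * ↑I.n + ↑I.n * ↑I.n + (↑x + 1))).setMem
      (2 * I.n + I.n * I.n + (x + 1)) (σ₂.reg 19)).setReg 10
      (2 * ↑I.n + ↑I.n * ↑I.n + (↑x + 1) + 2 ^ I.C.card)).setMem
      (2 * I.n + I.n * I.n + (x + 1) + 2 ^ I.C.card) (σ₂.reg 20))).mem with hmem'
    -- The two cells that are written hold no entries of sets with smaller codes.
    have hval : ∀ c ≤ x, I.val mem' c = I.val σ.mem c := by
      intro c hc
      unfold Input.val
      rw [hmem']
      simp [hm₂]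
      grind
    have harg : ∀ c ≤ x, I.arg mem' c = I.arg σ.mem c := by
      intro c hc
      unfold Input.arg
      rw [hmem']
      simp [hm₂]
      grind
    have hval' : I.val mem' (code I.C X) = σ₂.reg rBest := by
      unfold Input.val
      rw [hmem', hXc]
      simp
    have harg' : I.arg mem' (code I.C X) = σ₂.reg rArg := by
      unfold Input.arg
      rw [hmem', hXc]
      simp
    refine ⟨hx, by simpa using hX₂, ?_, ?_, ?_, ?_, ?_⟩
    · have : σ₂.reg rCnt = _ := (h₂.frame.2 _ (by simp)).trans hcnt
      simpa using this
    · intro r hr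
      rw [← hreg r hr, ← h₂.frame.2 r fun h' => hr (by simp only [List.mem_cons] at h' ⊢; tauto)]
      simp only [List.mem_cons, not_or] at hr
      simp [hr]
    · intro i hi
      rw [← h.mem i hi, ← hm₂]
      simp
      grind
    · rw [hval 0 (by omega), h.zero]
    · intro Z hZ hne hle
      rcases hle.lt_or_eq with hlt | heq
      · exact (h.entry Z hZ hne (by omega)).congr (fun c hc => hval c (by omega))
          (harg _ (by omega))
      · obtain rfl := code_injective hZ hX (heq.trans hXc.symm)
        have h1 : ∀ Y, Y ⊆ Z → Y.Nonempty →
            I.val mem' (code I.C (Z \ Y)) = I.val σ₁.mem (code I.C (Z \ Y)) := by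
          intro Y hY hne
          have := code_sdiff_add (C := I.C) hY
          have := (code_pos_iff (C := I.C)).2 hne
          rw [hm]
          exact hval _ (by omega)
        have h2 : ∀ Y, Splits I mem' Z Y ↔ Splits I σ₁.mem Z Y := fun Y =>
          ⟨fun h => ⟨h.subset, h.nonempty, h.good, h1 Y h.subset h.nonempty ▸ h.rest⟩,
            fun h => ⟨h.subset, h.nonempty, h.good, (h1 Y h.subset h.nonempty).symm ▸ h.rest⟩⟩
        constructor
        · intro h0
          rw [hval'] at h0 ⊢
          rw [harg']
          obtain ⟨Y, hY, ha, hv⟩ := h₂.attained h0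
          exact ⟨Y, (h2 Y).2 hY, ha, 
            hv.trans (by rw [splitGain, splitGain, h1 Y hY.subset hY.nonempty])⟩
        · intro Y hY
          rw [hval', splitGain, h1 Y hY.subset hY.nonempty]
          exact h₂.upper Y ((h2 Y).1 hY) ((code_pos_iff (C := I.C)).2 hY.nonempty)

/-- After the dynamic program all entries satisfy the recurrence, since the rest of a split has a
smaller code than the set and its entry has been computed before. -/
theorem runs_table {s : State} (hs : Ready I s) (hw : ∀ v : Fin I.n, s.mem v = I.w v) :
    Runs table s (4 + (2 ^ I.C.card * (2 ^ I.C.card * (30 * (I.n + 1) ^ 2 + 1) + 11) + 1))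
      (TableInv I s (code I.C I.C)) := by
  have hK := code_self (C := I.C)
  have hinit : Runs (.const rX 0 ;; .const rA 0 ;; .store rM rA ;; .sub rCnt rK rOne) s 4
      (TableInv I s 0) := by
    refine (Runs.of_wp ?_).mono (by decide) fun _ => id
    have e1 : (2 * (I.n : ℤ) + I.n * I.n).toNat = 2 * I.n + I.n * I.n := by
      rw [← Int.toNat_natCast (2 * I.n + I.n * I.n)]; push_cast; rfl
    simp [wp, hs.M, hs.K, hs.one, e1]
    refine ⟨by positivity, by positivity, by simp, by simp, ?_, ?_, ?_, ?_⟩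
    · intro r hr
      simp only [List.mem_cons, not_or] at hr
      simp [hr]
    · intro i hi
      simp
      omega
    · simp [Input.val]
    · intro X _ hne hle
      have := (code_pos_iff (C := I.C)).2 hne
      omega
  refine hinit.seq fun σ hσ => ?_
  refine Runs.whilePos (T := 2 ^ I.C.card * (30 * (I.n + 1) ^ 2 + 1) + 10)
    (fun σ => ∃ x, TableInv I s x σ) ⟨_, hσ⟩ ?_ ?_ _ ?_
  · rintro σ ⟨x, hx⟩ hpos
    refine (runs_tableBody hs hw hx hpos).mono le_rfl fun σ' h => ⟨⟨_, h⟩, ?_⟩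
    rw [h.cnt, hx.cnt]
    push_cast
    omega
  · rintro σ ⟨x, hx⟩ hpos
    obtain rfl : x = code I.C I.C := by
      have := hx.cnt
      have := hx.lt
      omega
    exact hx
  · rw [hσ.cnt]
    omega

/-! ### Initialization -/

open Classical in
/-- The preparation has treated the vertices below `i`. -/
structure PrepareInv (I : Input) (i : ℕ) (σ : State) : Prop where
  le : i ≤ I.n
  n : σ.reg rN = I.n
  wmax : σ.reg rWmax = I.wmax
  one : σ.reg rOne = 1
  V : σ.reg rV = I.n - i
  A : σ.reg rA = I.n + i
  row : σ.reg rRow = (2 * I.n + I.n * i + i : ℕ)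
  K : σ.reg rK = place I.C i
  M : σ.reg rM = (2 * I.n + I.n * i : ℕ)
  weights : ∀ v : Fin I.n, σ.mem v = I.w v
  cover : ∀ v : Fin I.n, σ.mem (I.n + v) =
    if v ∈ I.C then if v.val < i then (place I.C v : ℤ) else 1 else 0
  adj : ∀ v u : Fin I.n, σ.mem (2 * I.n + I.n * v + u) =
    if (u = v ∧ v.val < i) ∨ I.G.Adj v u then 1 else 0

theorem runs_prepareBody {σ : State} {i : ℕ} (h : PrepareInv I i σ) (hi : i < I.n) :
    Runs prepareBody σ 10 (PrepareInv I (i + 1)) := by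
  classical
  have hp : σ.mem (I.n + i) = _ := h.cover ⟨i, hi⟩
  simp only [lt_irrefl, if_false] at hp
  have e1 : ((I.n : ℤ) + i).toNat = I.n + i := by omega
  have e2 : (2 * (I.n : ℤ) + I.n * i + i).toNat = 2 * I.n + I.n * i + i := by
    rw [← Int.toNat_natCast (2 * I.n + I.n * i + i)]; push_cast; rfl
  have hpl := place_succ (C := I.C) hi
  -- The cell that is written lies in the adjacency matrix, on the diagonal.
  have d1 : ∀ v : Fin I.n, v.val ≠ 2 * I.n + I.n * i + i := fun v => by have := v.2; omega
  have d2 : ∀ v : Fin I.n, I.n + v.val ≠ 2 * I.n + I.n * i + i := fun v => by have := v.2; omega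
  have d3 : ∀ v u : Fin I.n,
      2 * I.n + I.n * v.val + u.val = 2 * I.n + I.n * i + i ↔ v.val = i ∧ u = v := by
    intro v u
    constructor
    · intro heq
      have hd : (I.n * v.val + u.val) / I.n = (I.n * i + i) / I.n := by congr 1; omega
      rw [Nat.mul_add_div (by omega), Nat.mul_add_div (by omega), Nat.div_eq_of_lt u.2,
        Nat.div_eq_of_lt hi] at hd
      have hv : v.val = i := by omega
      refine ⟨hv, Fin.ext ?_⟩
      rw [hv] at heq ⊢
      omega
    · rintro ⟨rfl, rfl⟩
      rfl
  have d4 : ∀ v : Fin I.n, v.val ≠ I.n + i := fun v => by have := v.2; omega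
  have d5 : ∀ v u : Fin I.n, 2 * I.n + I.n * v.val + u.val ≠ I.n + i := fun v u => by omega
  have d6 : ∀ v : Fin I.n, v.val < i + 1 ↔ v.val < i ∨ v = ⟨i, hi⟩ := fun v => by
    rw [Fin.ext_iff]; simp; omega
  have hC : 0 < σ.mem (I.n + i) ↔ (⟨i, hi⟩ : Fin I.n) ∈ I.C := by
    rw [hp]; split_ifs with h <;> simp [h]
  refine (Runs.of_wp (p := prepareBody) (Q := PrepareInv I (i + 1)) ?_).mono (by decide)
    fun _ => id
  simp [prepareBody, wp, h.n, h.one, h.V, h.A, h.row, h.M, h.K, e1, e2]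
  refine ⟨by positivity, by positivity, fun h1 => ⟨by positivity, ?_⟩, fun h1 => ?_⟩
  · rw [hC] at h1
    rw [if_pos h1] at hpl
    refine ⟨hi, by simp [h.n], by simp [h.wmax], by simp [h.one], by simp; ring, by simp; ring,
      by simp; ring, by simp [hpl], by simp; ring, ?_, ?_, ?_⟩
    · intro v
      simp [d1, d4, h.weights]
    · intro v
      by_cases hv : v = ⟨i, hi⟩
      · subst hv
        simp [h1]
      · have : v.val ≠ i := fun e => hv (Fin.ext e)
        simp [d2, this, h.cover, d6, hv]
    · intro v u
      simp only [State.setReg_mem, State.setMem_mem, d3, d5, h.adj, d6, if_false]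
      grind
  · rw [← not_lt, hC] at h1
    rw [if_neg h1] at hpl
    refine ⟨hi, by simp [h.n], by simp [h.wmax], by simp [h.one], by simp; ring, by simp; ring,
      by simp; ring, by simp [hpl, h.K], by simp; ring, ?_, ?_, ?_⟩
    · intro v
      simp [d1, h.weights]
    · intro v
      simp only [State.setReg_mem, State.setMem_mem, if_neg (d2 v), h.cover, d6]
      by_cases hv : v = ⟨i, hi⟩
      · subst hv
        simp [h1]
      · simp [hv]
    · intro v u
      simp only [State.setReg_mem, State.setMem_mem, d3, h.adj, d6]
      grind

theorem getD_ofFn {n i : ℕ} (f : Fin n → ℤ) (h : i < n) : (List.ofFn f).getD i 0 = f ⟨i, h⟩ := by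
  simp [List.getD, h]

theorem init_weights (v : Fin I.n) : I.init.mem v = I.w v := by
  simp only [Input.init, Input.cells]
  rw [List.append_assoc, List.getD_append _ _ _ _ (by simp), getD_ofFn _ v.2]

open Classical in
theorem init_cover (v : Fin I.n) : I.init.mem (I.n + v) = if v ∈ I.C then 1 else 0 := by
  simp only [Input.init, Input.cells]
  rw [List.append_assoc, List.getD_append_right _ _ _ _ (by simp),
    List.getD_append _ _ _ _ (by simp)]
  simp only [List.length_ofFn, Nat.add_sub_cancel_left]
  rw [getD_ofFn _ v.2]

open Classical in
theorem init_adj (v u : Fin I.n) :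
    I.init.mem (2 * I.n + I.n * v + u) = if I.G.Adj v u then 1 else 0 := by
  have hlt : I.n * v + u < I.n * I.n := by
    have h1 : I.n * (v + 1) ≤ I.n * I.n := Nat.mul_le_mul_left _ v.2
    have h2 := u.2
    nlinarith
  simp only [Input.init, Input.cells]
  rw [List.getD_append_right _ _ _ _ (by simp; omega)]
  have : 2 * I.n + I.n * v + u - (List.ofFn I.w ++
      List.ofFn (fun v : Fin I.n => if v ∈ I.C then (1 : ℤ) else 0)).length = I.n * v + u := by
    simp
    omega
  rw [this, getD_ofFn _ hlt]
  have hn : 0 < I.n := by have := v.2; omega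
  have e1 : (⟨I.n * v + u, hlt⟩ : Fin (I.n * I.n)).divNat = v := by
    ext
    simp [Fin.divNat, Nat.mul_add_div hn]
  have e2 : (⟨I.n * v + u, hlt⟩ : Fin (I.n * I.n)).modNat = u := by
    ext
    simp [Fin.modNat, Nat.mod_eq_of_lt u.2]
  rw [e1, e2]

theorem runs_prepare : Runs prepare I.init (11 * I.n + 7) fun σ =>
    Ready I σ ∧ ∀ v : Fin I.n, σ.mem v = I.w v := by
  classical
  have hinit : Runs (.const rOne 1 ;; .add rM rN rN ;; .move rRow rM ;; .const rK 1 ;;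
      .move rV rN ;; .move rA rN) I.init 6 (PrepareInv I 0) := by
    refine Runs.of_wp ?_
    simp only [wp]
    have h0 : I.init.reg 0 = I.n := by simp [Input.init]
    have h1 : I.init.reg 1 = I.wmax := by simp [Input.init]
    refine ⟨by simp, by simp [h0], by simp [h1], by simp, by simp [h0], by simp [h0],
      by simp [h0]; ring, by simp [place_zero], by simp [h0]; ring, ?_, ?_, ?_⟩
    · simpa using init_weights
    · simpa using init_cover
    · simpa using init_adj
  refine (hinit.seq (T₂ := I.n * 11 + 1) fun σ hσ => ?_).mono (by omega) fun _ => id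
  refine Runs.whilePos (fun σ => ∃ i, PrepareInv I i σ) ⟨_, hσ⟩ ?_ ?_ _ ?_
  · rintro σ ⟨i, hi⟩ hpos
    have hV := hi.V
    exact (runs_prepareBody hi (by omega)).mono le_rfl fun σ' h =>
      ⟨⟨_, h⟩, by rw [h.V, hV]; push_cast; omega⟩
  · rintro σ ⟨i, hi⟩ hpos
    have hV := hi.V
    obtain rfl : i = I.n := by have := hi.le; omega
    refine ⟨⟨hi.n, hi.wmax, hi.one, ?_, hi.M, ?_, ?_⟩, hi.weights⟩
    · rw [hi.K, place_all]
    · intro v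
      rw [hi.cover]
      simp
    · intro v u
      rw [hi.adj]
      simp
  · rw [hσ.V]
    simp

/-! ### Output -/

theorem gain_nonneg (Y : Finset (Fin I.n)) : 0 ≤ gain I.tr I.w Y := by
  refine Finset.sum_nonneg fun v _ => ?_
  split_ifs
  · exact (I.w_pos v).le
  · exact le_rfl

/-- In a correct table, the entry of a set is at least the total gain of every good partition. -/
theorem sum_gain_le {mem : ℕ → ℤ} (h0 : I.val mem 0 = 0)
    (h : ∀ X ⊆ I.C, X.Nonempty → EntryOK I mem X) {𝒬 : Finset (Finset (Fin I.n))}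
    {X : Finset (Fin I.n)} (hX : X ⊆ I.C) (h𝒬 : IsGoodPartition I.tr I.w I.C I.wmax X 𝒬) :
    0 ≤ I.val mem (code I.C X) ∧ ∑ Y ∈ 𝒬, gain I.tr I.w Y ≤ I.val mem (code I.C X) := by
  induction 𝒬 using Finset.induction_on generalizing X with
  | empty =>
    have := h𝒬.union
    obtain rfl : X = ∅ := by simpa [eq_comm] using this
    simp [code, h0]
  | insert Y 𝒬 hY ih =>
    have hdis : Disjoint Y (𝒬.biUnion id) := by
      rw [Finset.disjoint_biUnion_right]
      intro Z hZ
      exact h𝒬.disjoint Y (by simp) Z (by simp [hZ]) (by rintro rfl; exact hY hZ)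
    have hu := h𝒬.union
    rw [Finset.biUnion_insert, id] at hu
    have hsd : X \ Y = 𝒬.biUnion id := by
      rw [← hu, Finset.union_sdiff_left, Finset.sdiff_eq_self_of_disjoint hdis.symm]
    have hYX : Y ⊆ X := hu ▸ Finset.subset_union_left
    obtain ⟨h1, h2⟩ := ih (X := X \ Y) (Finset.sdiff_subset.trans hX)
      ⟨fun Z hZ => h𝒬.nonempty Z (by simp [hZ]), fun Z hZ => h𝒬.good Z (by simp [hZ]),
        fun Z hZ W hW => h𝒬.disjoint Z (by simp [hZ]) W (by simp [hW]), hsd.symm⟩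
    have hne := h𝒬.nonempty Y (by simp)
    have h3 := (h X hX (hne.mono hYX)).upper Y ⟨hYX, hne, h𝒬.good Y (by simp), h1⟩
    have h4 := gain_nonneg (I := I) Y
    rw [Finset.sum_insert hY]
    unfold splitGain at h3
    constructor <;> linarith

/-- The states agree on the memory from cell `n` on and on all registers outside `l`. The cells
below `n` are overwritten by the output. -/
def HighFrame (n : ℕ) (l : List ℕ) (s s' : State) : Prop :=
  (∀ i, n ≤ i → s'.mem i = s.mem i) ∧ ∀ r, r ∉ l → s'.reg r = s.reg r

theorem HighFrame.ready {l : List ℕ} {s s' : State} (h : HighFrame I.n l s s') (hs : Ready I s)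
    (hl : ∀ r ∈ [rN, rWmax, rOne, rK, rM], r ∉ l) : Ready I s' :=
  hs.congr (fun r hr => h.2 r (hl r hr)) fun i hi _ => h.1 i hi

theorem HighFrame.setReg {n : ℕ} {l : List ℕ} {s σ : State} {r : ℕ} {z : ℤ}
    (h : HighFrame n l s σ) (hr : r ∈ l) : HighFrame n l s (σ.setReg r z) := by
  refine ⟨h.1, fun r' hr' => ?_⟩
  rw [State.setReg_reg, if_neg (by rintro rfl; exact hr' hr), h.2 r' hr']

theorem HighFrame.setMem {n : ℕ} {l : List ℕ} {s σ : State} {i : ℕ} {z : ℤ}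
    (h : HighFrame n l s σ) (hi : i < n) : HighFrame n l s (σ.setMem i z) := by
  refine ⟨fun j hj => ?_, h.2⟩
  rw [State.setMem_mem, if_neg (by omega), h.1 j hj]

theorem HighFrame.trans_frame {n : ℕ} {l l' : List ℕ} {s σ σ' : State}
    (h : HighFrame n l s σ) (h' : Frame l' σ σ') (hl : l' ⊆ l) : HighFrame n l s σ' :=
  ⟨fun i hi => by rw [h'.1, h.1 i hi],
    fun r hr => (h'.2 r fun hr' => hr (hl hr')).trans (h.2 r hr)⟩

theorem HighFrame.refl {n : ℕ} {l : List ℕ} {s : State} : HighFrame n l s s :=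
  ⟨fun _ _ => rfl, fun _ _ => rfl⟩

/-- The registers that a loop over the vertices with a scan of each row changes. -/
abbrev scanRegs : List ℕ := [rV, rU, rRow, rHit, rMiss, rRem, rP, rA, rE]

open Classical in
/-- The vertices from `i` on have been tested for being isolated. -/
structure IsoInv (I : Input) (s : State) (i : ℕ) (σ : State) : Prop where
  frame : HighFrame I.n (rOk :: scanRegs) s σ
  low : ∀ v : Fin I.n, v.val < i → σ.mem v = I.w v
  high : ∀ v : Fin I.n, i ≤ v.val → σ.mem v = if (I.tr v).Nonempty then 1 else 0
  ok : 0 < σ.reg rOk ↔ 0 < s.reg rOk ∧ ∀ v : Fin I.n, i ≤ v.val → I.tr v = ∅ → I.w v ≤ I.wmax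

theorem forall_le_iff {n i : ℕ} (hi : i < n) {P : Fin n → Prop} :
    (∀ u : Fin n, i ≤ u.val → P u) ↔ (∀ u : Fin n, i + 1 ≤ u.val → P u) ∧ P ⟨i, hi⟩ := by
  constructor
  · exact fun h => ⟨fun u hu => h u (by omega), h _ le_rfl⟩
  · rintro ⟨h1, h2⟩ u hu
    rcases hu.lt_or_eq with h | rfl
    · exact h1 u h
    · exact h2

open Classical in
theorem runs_isolated {s : State} (hs : Ready I s) (hw : ∀ v : Fin I.n, s.mem v = I.w v)
    (hX : s.reg rX = code I.C I.C) :
    Runs isolated s (I.n * (13 * I.n + 15) + 4) fun σ =>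
      HighFrame I.n (rOk :: rY :: scanRegs) s σ ∧
      (∀ v : Fin I.n, σ.mem v = if (I.tr v).Nonempty then 1 else 0) ∧
      (0 < σ.reg rOk ↔ 0 < s.reg rOk ∧ ∀ v, I.tr v = ∅ → I.w v ≤ I.wmax) := by
  have hinit : Runs (.move rY rX) s 1 fun σ => σ = s.setReg rY (code I.C I.C) :=
    Runs.of_wp (by simp [wp, hX])
  refine (hinit.seq (T₂ := I.n * (13 * I.n + 5 + 7 + 3) + 3) fun s' hs' => ?_).mono
    (by rw [show 13 * I.n + 5 + 7 + 3 = 13 * I.n + 15 by ring]; omega) fun _ => id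
  have hR : Ready I s' := by
    rw [hs']
    exact hs.congr (by simp) (by simp)
  have hw' : ∀ v : Fin I.n, s'.mem v = I.w v := by simpa [hs'] using hw
  have hY : s'.reg rY = code I.C I.C := by simp [hs']
  refine runs_forVertices (IsoInv I s') hR.M ?_ ?_ ?_ ?_ ?_
  · rintro i σ z z' ⟨h1, h2, h3, h4⟩
    refine ⟨?_, by simpa using h2, by simpa using h3, by simpa using h4⟩
    repeat refine HighFrame.setReg ?_ (by simp)
    exact h1
  · intro i σ h
    exact ⟨(h.frame.ready hR (by simp)).n, (h.frame.ready hR (by simp)).one⟩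
  · exact ⟨HighFrame.refl, fun v _ => hw' v, fun v h => absurd v.2 (by omega),
      ⟨fun h => ⟨h, fun v hv => absurd v.2 (by omega)⟩, fun h => h.1⟩⟩
  · intro v σ hσ hv hrow
    refine (runs_scan (hσ.frame.ready hR (by simp)) hrow (Finset.Subset.refl _)
      ((hσ.frame.2 _ (by simp)).trans hY)).seq (T₂ := 7) ?_
    rintro σ' ⟨hf, hhit, -⟩
    have hF := hσ.frame.trans_frame hf (by simp)
    have hR' := hF.ready hR (by simp)
    have hv' : σ'.reg rV = v := (hf.2 _ (by simp)).trans hv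
    have hrow' := hf.2 rRow (by simp)
    rw [Finset.inter_eq_left.2 trace_subset] at hhit
    have hlow := hσ.low
    have hhigh := hσ.high
    rw [← hf.1] at hlow hhigh
    have hok := hσ.ok
    rw [← hf.2 rOk (by simp)] at hok
    have hok' := forall_le_iff v.2 (P := fun v => I.tr v = ∅ → I.w v ≤ I.wmax)
    have hinj : ∀ u : Fin I.n, u.val = v.val ↔ u = v := fun u => Fin.ext_iff.symm
    refine (Runs.of_wp (p := isoTail) ?_).mono (by decide) fun _ => id
    simp [isoTail, wp, hv', hR'.one, hR'.wmax, hlow v (by omega)]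
    refine ⟨fun h1 => ?_, fun h1 => ⟨fun h2 => ?_, fun h2 => ?_⟩⟩
    all_goals
      refine ⟨⟨?_, ?_, ?_, ?_⟩, hv.symm, hrow'⟩
      · first
        | exact hF.setMem v.2
        | refine HighFrame.setMem ?_ v.2
          repeat refine HighFrame.setReg ?_ (by simp)
          exact hF
      · intro u hu
        have : u.val ≠ v.val := by omega
        simp [this, hlow u (by omega)]
      · intro u hu
        by_cases huv : u = v
        · subst huv
          simp [← hhit, h1]
        · have : u.val ≠ v.val := fun e => huv (Fin.ext e)
          simp [this, hhigh u (by omega)]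
      · rw [hok']
        simp only [Fin.eta, ← Finset.not_nonempty_iff_eq_empty, ← hhit] at hok ⊢
        simp
        grind
  · intro σ h
    refine ⟨⟨fun i hi => by rw [h.frame.1 i hi, hs']; simp, fun r hr => ?_⟩,
      fun v => h.high v (Nat.zero_le _), ?_⟩
    · rw [h.frame.2 r (by simp only [List.mem_cons, not_or] at hr ⊢; tauto), hs',
        State.setReg_reg, if_neg (by rintro rfl; simp at hr)]
    · rw [h.ok, hs']
      simp

open Classical in
/-- The part `Y` has been processed for the vertices from `i` on. -/
structure MarkInv (I : Input) (𝒬 : Finset (Finset (Fin I.n))) (Y : Finset (Fin I.n)) (s : State)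
    (i : ℕ) (σ : State) : Prop where
  frame : HighFrame I.n scanRegs s σ
  low : ∀ v : Fin I.n, v.val < i → σ.mem v = if v ∈ separator I.tr 𝒬 then 1 else 0
  high : ∀ v : Fin I.n, i ≤ v.val → σ.mem v = if v ∈ separator I.tr (insert Y 𝒬) then 1 else 0

open Classical in
theorem runs_mark {s : State} {𝒬 : Finset (Finset (Fin I.n))} {Y : Finset (Fin I.n)}
    (hs : Ready I s) (hY : Y ⊆ I.C) (hYc : s.reg rY = code I.C Y)
    (hmem : ∀ v : Fin I.n, s.mem v = if v ∈ separator I.tr 𝒬 then 1 else 0) :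
    Runs (forVertices (scan ;; markTail)) s (I.n * (13 * I.n + 12) + 3) (MarkInv I 𝒬 Y s 0) := by
  refine (runs_forVertices (T := 13 * I.n + 5 + 4) (MarkInv I 𝒬 Y s) hs.M ?_ ?_ ?_ ?_
    fun _ => id)
  · rintro i σ z z' ⟨h1, h2, h3⟩
    refine ⟨?_, by simpa using h2, by simpa using h3⟩
    repeat refine HighFrame.setReg ?_ (by simp)
    exact h1
  · intro i σ h
    exact ⟨(h.frame.ready hs (by simp)).n, (h.frame.ready hs (by simp)).one⟩
  · exact ⟨HighFrame.refl, fun v _ => hmem v, fun v h => absurd v.2 (by omega)⟩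
  · intro v σ hσ hv hrow
    refine (runs_scan (hσ.frame.ready hs (by simp)) hrow hY
      ((hσ.frame.2 _ (by simp)).trans hYc)).seq (T₂ := 4) ?_
    rintro σ' ⟨hf, hhit, hmiss⟩
    have hF := hσ.frame.trans_frame hf (by simp)
    have hv' : σ'.reg rV = v := (hf.2 _ (by simp)).trans hv
    have hrow' := hf.2 rRow (by simp)
    have hlow := hσ.low
    have hhigh := hσ.high
    rw [← hf.1] at hlow hhigh
    have hsep : v ∈ separator I.tr (insert Y 𝒬) ↔
        v ∈ separator I.tr 𝒬 ∧ ¬ (0 < σ'.reg rHit ∧ σ'.reg rMiss ≤ 0) := by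
      rw [← not_lt, hhit, hmiss, not_not]
      simp only [separator, Set.mem_ofPred_eq, Finset.mem_insert, forall_eq_or_imp]
      constructor
      · rintro ⟨h1, h2, h3⟩
        exact ⟨⟨h1, h3⟩, fun h => h2 h.2⟩
      · rintro ⟨⟨h1, h2⟩, h3⟩
        exact ⟨h1, fun h => h3 ⟨by rwa [Finset.inter_eq_left.2 h], h⟩, h2⟩
    have keep : ¬ (0 < σ'.reg rHit ∧ σ'.reg rMiss ≤ 0) →
        MarkInv I 𝒬 Y s v σ' ∧ σ'.reg rV = σ.reg rV ∧ σ'.reg rRow = σ.reg rRow := by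
      intro h
      refine ⟨⟨hF, fun u hu => hlow u (by omega), fun u hu => ?_⟩, hv'.trans hv.symm, hrow'⟩
      by_cases huv : u = v
      · subst huv
        simp [hlow u (by omega), hsep, h]
      · exact hhigh u (by have : u.val ≠ v.val := fun e => huv (Fin.ext e)
                          omega)
    refine (Runs.of_wp (p := markTail) ?_).mono (by decide) fun _ => id
    simp only [markTail, wp]
    refine ⟨fun h1 => ⟨fun h2 => keep (by omega), fun h2 => ⟨by simp [hv'], ?_⟩⟩,
      fun h1 => keep (by omega)⟩
    refine ⟨⟨?_, ?_, ?_⟩, by simp [hv, hv'], by simp [hrow']⟩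
    · refine HighFrame.setMem ?_ (by simp [hv'])
      refine HighFrame.setReg ?_ (by simp)
      exact hF
    · intro u hu
      have : u.val ≠ v.val := by omega
      simp [hv', this, hlow u (by omega)]
    · intro u hu
      by_cases huv : u = v
      · subst huv
        simp [hv', hsep, h1, h2]
      · have : u.val ≠ v.val := fun e => huv (Fin.ext e)
        simp [hv', this, hhigh u (by omega)]

open Classical in
/-- The parts of `𝒬` have been processed, and the stored parts of `X` are still to follow. -/
structure OutputInv (I : Input) (s : State) (X : Finset (Fin I.n))
    (𝒬 : Finset (Finset (Fin I.n))) (σ : State) : Prop where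
  subset : X ⊆ I.C
  regX : σ.reg rX = code I.C X
  frame : HighFrame I.n (rX :: rY :: scanRegs) s σ
  partition : IsGoodPartition I.tr I.w I.C I.wmax (I.C \ X) 𝒬
  nonneg : 0 ≤ I.val s.mem (code I.C X)
  total : ∑ Y ∈ 𝒬, gain I.tr I.w Y + I.val s.mem (code I.C X) = I.val s.mem (code I.C I.C)
  mem : ∀ v : Fin I.n, σ.mem v = if v ∈ separator I.tr 𝒬 then 1 else 0

theorem IsGoodPartition.insert {L : Fin I.n → Finset (Fin I.n)} {w : Fin I.n → ℤ}
    {C X Y : Finset (Fin I.n)} {wmax : ℤ} {𝒬 : Finset (Finset (Fin I.n))}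
    (h : IsGoodPartition L w C wmax (C \ X) 𝒬) (hX : X ⊆ C) (hY : Y ⊆ X) (hne : Y.Nonempty)
    (hgood : Good L w C wmax Y) :
    IsGoodPartition L w C wmax (C \ (X \ Y)) (insert Y 𝒬) ∧ Y ∉ 𝒬 := by
  have hdis : ∀ Z ∈ 𝒬, Disjoint Y Z := by
    intro Z hZ
    have hZX : Z ⊆ C \ X := by
      rw [← h.union]
      exact Finset.subset_biUnion_of_mem id hZ
    exact (Finset.disjoint_sdiff.mono_left hY).mono_right hZX
  refine ⟨⟨?_, ?_, ?_, ?_⟩,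
    fun hmem => hne.ne_empty ((Finset.disjoint_self_iff_empty _).1 (hdis Y hmem))⟩
  · intro Z hZ
    rcases Finset.mem_insert.1 hZ with rfl | hZ
    exacts [hne, h.nonempty Z hZ]
  · intro Z hZ
    rcases Finset.mem_insert.1 hZ with rfl | hZ
    exacts [hgood, h.good Z hZ]
  · intro Z hZ W hW hZW
    rcases Finset.mem_insert.1 hZ with rfl | hZ' <;> rcases Finset.mem_insert.1 hW with rfl | hW'
    exacts [absurd rfl hZW, hdis W hW', (hdis Z hZ').symm, h.disjoint Z hZ' W hW' hZW]
  · rw [Finset.biUnion_insert, h.union]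
    ext u
    have h1 := @hX u
    have h2 := @hY u
    simp only [id, Finset.mem_union, Finset.mem_sdiff]
    tauto

theorem runs_outputBody {s σ : State} (hs : Ready I s)
    (htab : ∀ X ⊆ I.C, X.Nonempty → EntryOK I s.mem X) {X : Finset (Fin I.n)}
    {𝒬 : Finset (Finset (Fin I.n))} (h : OutputInv I s X 𝒬 σ) (hpos : 0 < σ.reg rX) :
    Runs outputBody σ (I.n * (13 * I.n + 12) + 7) fun σ' =>
      (∃ X' 𝒬', OutputInv I s X' 𝒬' σ') ∧ σ'.reg rX < σ.reg rX := by
  rw [h.regX] at hpos ⊢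
  have hne : X.Nonempty := (code_pos_iff (C := I.C)).1 (by exact_mod_cast hpos)
  obtain ⟨Y, hY, harg, hval⟩ := (htab X h.subset hne).attained h.nonneg
  have hσ := h.frame.ready hs (by simp)
  have e2 : (2 * (I.n : ℤ) + I.n * I.n + code I.C X + 2 ^ I.C.card).toNat =
      2 * I.n + I.n * I.n + code I.C X + 2 ^ I.C.card := by
    rw [← Int.toNat_natCast (2 * I.n + I.n * I.n + code I.C X + 2 ^ I.C.card)]; push_cast; rfl
  have hcell : σ.mem (2 * I.n + I.n * I.n + code I.C X + 2 ^ I.C.card) = code I.C Y := by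
    rw [h.frame.1 _ (by nlinarith [Nat.zero_le (I.n * I.n), Nat.zero_le (2 ^ I.C.card)])]
    exact harg
  have hload : Runs (.add rA rM rX ;; .add rA rA rK ;; .load rY rA) σ 3 fun σ₁ =>
      Frame [rA, rY] σ σ₁ ∧ σ₁.reg rY = code I.C Y := by
    refine (Runs.of_wp ?_).mono (by decide) fun _ => id
    simp [wp, hσ.M, hσ.K, h.regX, e2, hcell]
    refine ⟨by positivity, ?_⟩
    repeat refine Frame.setReg ?_ (by simp)
    exact Frame.refl
  refine Runs.mono (T := 3 + ((I.n * (13 * I.n + 12) + 3) + 1)) ?_ (by omega) fun _ => id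
  refine hload.seq ?_
  rintro σ₁ ⟨hf₁, hY₁⟩
  have hF₁ := h.frame.trans_frame hf₁ (by simp)
  have hR₁ := hF₁.ready hs (by simp)
  refine (runs_mark hR₁ (hY.subset.trans h.subset) hY₁
    (fun v => by rw [hf₁.1]; exact h.mem v)).seq fun σ₂ h₂ => ?_
  have hX₂ : σ₂.reg rX = code I.C X := by rw [h₂.frame.2 _ (by simp), hf₁.2 _ (by simp), h.regX]
  have hY₂ : σ₂.reg rY = code I.C Y := (h₂.frame.2 _ (by simp)).trans hY₁
  have hcode := code_sdiff_add (C := I.C) hY.subset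
  have hYpos := (code_pos_iff (C := I.C)).2 hY.nonempty
  refine Runs.of_wp ?_
  simp only [wp, hX₂, hY₂]
  obtain ⟨hpart, hnot⟩ := h.partition.insert h.subset hY.subset hY.nonempty hY.good
  refine ⟨⟨X \ Y, insert Y 𝒬, Finset.sdiff_subset.trans h.subset, ?_, ?_, hpart, hY.rest, ?_,
    ?_⟩, ?_⟩
  · simp only [State.setReg_reg, if_true]
    omega
  · refine HighFrame.setReg ?_ (by simp)
    exact ⟨fun i hi => (h₂.frame.1 i hi).trans (hF₁.1 i hi), fun r hr =>
      (h₂.frame.2 r (fun h' => hr (by simp only [List.mem_cons] at h' ⊢; tauto))).trans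
        (hF₁.2 r hr)⟩
  · rw [Finset.sum_insert hnot, ← h.total, hval, splitGain]
    ring
  · intro v
    exact h₂.high v (Nat.zero_le _)
  · simp only [State.setReg_reg, if_true]
    omega

open Classical in
/-- Following the stored parts from the whole cover yields a good partition whose total gain is the
value of the cover. -/
theorem runs_output {s : State} (hs : Ready I s)
    (htab : ∀ X ⊆ I.C, X.Nonempty → EntryOK I s.mem X) (h0 : I.val s.mem 0 = 0)
    (hX : s.reg rX = code I.C I.C) (hnonneg : 0 ≤ I.val s.mem (code I.C I.C))
    (hmem : ∀ v : Fin I.n, s.mem v = if (I.tr v).Nonempty then 1 else 0) :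
    Runs output s (2 ^ I.C.card * (I.n * (13 * I.n + 12) + 8) + 1) fun σ =>
      ∃ 𝒬, IsGoodPartition I.tr I.w I.C I.wmax I.C 𝒬 ∧
        ∑ Y ∈ 𝒬, gain I.tr I.w Y = I.val s.mem (code I.C I.C) ∧
        ∀ v : Fin I.n, σ.mem v = if v ∈ separator I.tr 𝒬 then 1 else 0 := by
  refine Runs.whilePos (T := I.n * (13 * I.n + 12) + 7)
    (fun σ => ∃ X 𝒬, OutputInv I s X 𝒬 σ) ⟨I.C, ∅, ?_⟩ ?_ ?_ _ ?_
  · refine ⟨Finset.Subset.refl _, hX, HighFrame.refl, ?_, hnonneg, by simp, ?_⟩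
    · exact ⟨by simp, by simp, by simp, by simp⟩
    · simpa [separator] using hmem
  · rintro σ ⟨X, 𝒬, h⟩ hpos
    exact runs_outputBody hs htab h hpos
  · rintro σ ⟨X, 𝒬, h⟩ hpos
    have hcode : code I.C X = 0 := by
      have := h.regX
      omega
    obtain rfl : X = ∅ := by
      rw [← Finset.not_nonempty_iff_eq_empty, ← code_pos_iff (C := I.C)]
      omega
    refine ⟨𝒬, by simpa using h.partition, ?_, h.mem⟩
    have := h.total
    rw [hcode, h0] at this
    simpa using this
  · rw [hX]
    exact_mod_cast (code_lt (Finset.Subset.refl _)).le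

/-! ### Correctness and running time -/

/-- The program answers correctly. The bound is the sum of the bounds for its five phases, and the
dynamic program dominates. -/
theorem runs_solve : Runs solve I.init
    ((11 * I.n + 7) +
      ((4 + (2 ^ I.C.card * (2 ^ I.C.card * (30 * (I.n + 1) ^ 2 + 1) + 11) + 1)) +
      (3 + ((I.n * (13 * I.n + 15) + 4) +
      ((2 ^ I.C.card * (I.n * (13 * I.n + 12) + 8) + 1) + 1 + 1))))) I.CorrectAnswer := by
  classical
  refine runs_prepare.seq ?_
  rintro s ⟨hs, hw⟩
  refine (runs_table hs hw).seq fun σ hσ => ?_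
  have hR := hσ.ready hs
  have hK := code_self (C := I.C)
  have htab : ∀ X ⊆ I.C, X.Nonempty → EntryOK I σ.mem X := by
    intro X hX hne
    refine hσ.entry X hX hne ?_
    have := code_lt hX
    omega
  have hload : Runs (.add rA rM rX ;; .load rE rA ;; .add rOk rE rOne) σ 3 fun σ₁ =>
      Frame [rA, rE, rOk] σ σ₁ ∧ σ₁.reg rOk = I.val σ.mem (code I.C I.C) + 1 := by
    have e1 : (2 * (I.n : ℤ) + I.n * I.n + code I.C I.C).toNat =
        2 * I.n + I.n * I.n + code I.C I.C := by
      rw [← Int.toNat_natCast (2 * I.n + I.n * I.n + code I.C I.C)]; push_cast; rfl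
    refine (Runs.of_wp ?_).mono (by decide) fun _ => id
    simp [wp, hR.M, hσ.X, hR.one, e1, Input.val]
    refine ⟨by positivity, ?_⟩
    repeat refine Frame.setReg ?_ (by simp)
    exact Frame.refl
  refine hload.seq ?_
  rintro σ₁ ⟨hf₁, hok₁⟩
  have hX₁ : σ₁.reg rX = code I.C I.C := (hf₁.2 _ (by simp)).trans hσ.X
  refine (runs_isolated (hR.frame hf₁ (by simp))
    (fun v => by rw [hf₁.1, hσ.mem _ (by have := v.2; omega), hw]) hX₁).seq ?_
  rintro σ₂ ⟨hf₂, hmem₂, hok₂⟩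
  rw [hok₁] at hok₂
  have hR₂ := hf₂.ready (hR.frame hf₁ (by simp)) (by simp)
  have hval : ∀ c, I.val σ₂.mem c = I.val σ.mem c := by
    intro c
    unfold Input.val
    rw [hf₂.1 _ (by nlinarith [Nat.zero_le (I.n * I.n), Nat.zero_le c]), hf₁.1]
  have harg : ∀ c, I.arg σ₂.mem c = I.arg σ.mem c := by
    intro c
    unfold Input.arg
    rw [hf₂.1 _ (by nlinarith [Nat.zero_le (I.n * I.n), Nat.zero_le (2 ^ I.C.card)]), hf₁.1]
  have htab₂ : ∀ X ⊆ I.C, X.Nonempty → EntryOK I σ₂.mem X := fun X hX hne =>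
    (htab X hX hne).congr (fun c _ => hval c) (harg _)
  have hzero : I.val σ₂.mem 0 = 0 := (hval 0).trans hσ.zero
  refine Runs.ifPos (fun hpos => ?_) (fun hneg => ?_)
  · obtain ⟨hnn, hiso⟩ := hok₂.1 hpos
    refine (runs_output hR₂ htab₂ hzero ((hf₂.2 _ (by simp)).trans hX₁)
      (by rw [hval]; omega) hmem₂).seq (T₂ := 1) ?_
    rintro σ₃ ⟨𝒬, h𝒬, hsum, hmem₃⟩
    refine Runs.of_wp (p := .const rN 1) ?_
    refine Or.inl ⟨by simp, separator I.tr 𝒬, ⟨feasible_separator I.w_pos I.cover h𝒬 hiso, ?_⟩,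
      by simpa using hmem₃⟩
    rintro T ⟨hT₁, hT₂, hT₃⟩
    obtain ⟨-, 𝒬', h𝒬', hle⟩ := exists_partition_of_feasible I.w_pos I.cover hT₁ hT₂ hT₃
    have := (sum_gain_le hzero htab₂ (Finset.Subset.refl _) h𝒬').2
    rw [weight_separator h𝒬, hsum]
    linarith
  · refine (Runs.of_wp (p := .const rN 0) ?_).mono (by simp [cost]) fun _ => id
    refine Or.inr ⟨by simp, ?_⟩
    rintro ⟨T, hT₁, hT₂, hT₃⟩
    obtain ⟨hiso, 𝒬', h𝒬', -⟩ := exists_partition_of_feasible I.w_pos I.cover hT₁ hT₂ hT₃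
    have := (sum_gain_le hzero htab₂ (Finset.Subset.refl _) h𝒬').1
    rw [hval] at this
    exact absurd (hok₂.2 ⟨by omega, hiso⟩) (not_lt.2 hneg)

end WVI

/-- Annotated Weighted Vertex Integrity with Vertex Cover can be solved in time
`2 ^ O(|C|) * n ^ O(1)`: one program answers every input correctly within this number of steps. -/
theorem mainTheorem9 :
    ∃ (p : WVI.Program) (A a b : ℕ), ∀ I : WVI.Input,
      ∃ (t : ℕ) (s : WVI.State), WVI.Exec p I.init t s ∧ I.CorrectAnswer s ∧
        t ≤ A * 2 ^ (a * I.C.card) * (I.n + 1) ^ b := by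
  -- The dynamic program tries `4 ^ |C|` pairs of codes, at quadratic cost for each pair.
  refine ⟨WVI.solve, 200, 2, 2, fun I => ?_⟩
  obtain ⟨t, s, h1, h2, h3⟩ := WVI.runs_solve (I := I)
  refine ⟨t, s, h1, h3, h2.trans ?_⟩
  have hK : 1 ≤ 2 ^ I.C.card := Nat.one_le_two_pow
  rw [mul_comm 2, pow_mul]
  generalize 2 ^ I.C.card = K at *
  generalize I.n = n
  obtain ⟨k, rfl⟩ : ∃ k, K = k + 1 := ⟨K - 1, by omega⟩
  ring_nf
  nlinarith [Nat.zero_le (k * n), Nat.zero_le (k * n ^ 2), Nat.zero_le (k ^ 2 * n),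
    Nat.zero_le (k ^ 2 * n ^ 2), Nat.zero_le (k ^ 2), Nat.zero_le (n ^ 2)]
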